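/- Let $N\ge 2$, $\varepsilon>0$, and let $\alpha\in\mathbb R$ not be a non-zero even integer (in particular every $\alpha\in[0,2)$ is allowed). Write points of $\mathbb R^{2N}$ as $(\mathbf x_1,\dots,\mathbf x_N)$ with $\mathbf x_j=(x_j,y_j)\in\mathbb R^2$, let $(x,y)^\perp=(-y,x)$, and put $$\mathbf A_j=\sum_{k\ne j}\frac{(\mathbf x_j-\mathbf x_k)^\perp}{|\mathbf x_j-\mathbf x_k|^2},\qquad D_j=-\mathrm i\nabla_{\mathbf x_j}+\alpha\mathbf A_j,\qquad V_\varepsilon(x,y)=x^2+\frac{y^2}{\varepsilon^2}.$$ Let $L^2_{\mathrm{sym}}(\mathbb R^{2N})$ be the space of complex-valued $L^2$ functions that are invariant under permutations of $\mathbf x_1,\dots,\mathbf x_N$, and let $\mathcal C$ be the space of permutation-invariant functions in $C_c^\infty(\mathbb R^{2N}\setminus\mathbb D)$, where $\mathbb D=\{\mathbf x_j=\mathbf x_l\text{ for some }j\neq l\}$. Let $H^{2D}_\varepsilon$ be the Friedrichs extension on $L^2_{\mathrm{sym}}(\mathbb R^{2N})$ of $\sum_{j=1}^N\left(D_j^2+V_\varepsilon(\mathbf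 x_j)\right)$ defined on $\mathcal C$. Its quadratic form domain $\mathcal D_q(H^{2D}_\varepsilon)$ is the domain of the closure of the form $$\mathcal E(\phi)=\sum_{j=1}^N\int_{\mathbb R^{2N}}\left(|D_j\phi|^2+V_\varepsilon(\mathbf x_j)|\phi|^2\right),\qquad \phi\in\mathcal C,$$ i.e. the completion of $\mathcal C$, inside $L^2$, under the norm $\sqrt{\mathcal E(\cdot)}+\|\cdot\|_{L^2}$. Then $$\mathcal D_q(H^{2D}_\varepsilon)\subset H^1_V(\mathbb R^{2N}):=\left\{\phi\in H^1(\mathbb R^{2N}) : |\mathbf x_j|\phi\in L^2(\mathbb R^{2N})\text{ for all }j\right\}.$$ Moreover $H^{2D}_\varepsilon$ has compact resolvent: $H^{2D}_\varepsilon+1$ is a bijection from the domain of $H^{2D}_\varepsilon$ onto $L^2_{\mathrm{sym}}(\mathbb R^{2N})$, and its inverse is a compact operator on $L^2_{\mathrm{sym}}(\mathbb R^{2N})$. -/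

import Mathlib

open MeasureTheory Filter Topology
open scoped ContDiff ComplexConjugate

noncomputable section

namespace Anyon

/-- The plane `ℝ²` with its Euclidean norm. -/
abbrev Plane : Type := EuclideanSpace ℝ (Fin 2)

/-- Configurations `(x₁, …, x_N)` of `N` points of the plane, that is `ℝ^{2N}`; its `volume` is
Lebesgue measure. -/
abbrev Config (N : ℕ) : Type := Fin N → Plane

/-- `L²(ℝ^{2N}; ℂ)`. -/
abbrev L2 (N : ℕ) : Type := Lp ℂ 2 (volume : Measure (Config N))

/-- `(x, y)^⊥ = (-y, x)`. -/
def perp (v : Plane) : Plane := !₂[-v 1, v 0]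

/-- The set of configurations in which two particles coincide. -/
def diagonal (N : ℕ) : Set (Config N) := {x | ∃ j l, j ≠ l ∧ x j = x l}

/-- The vector potential `A_j = ∑_{k ≠ j} (x_j - x_k)^⊥ / |x_j - x_k|²`. -/
def vectorPotential {N : ℕ} (j : Fin N) (x : Config N) : Plane :=
  ∑ k ∈ Finset.univ.erase j, (‖x j - x k‖ ^ 2)⁻¹ • perp (x j - x k)

/-- The anisotropic harmonic trap `V_ε(x, y) = x² + y² / ε²`. -/
def trap (ε : ℝ) (v : Plane) : ℝ := v 0 ^ 2 + v 1 ^ 2 / ε ^ 2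

/-- The unit vector of `ℝ^{2N}` along the `a`-th coordinate of the `j`-th particle. -/
def unitVec {N : ℕ} (j : Fin N) (a : Fin 2) : Config N :=
  Pi.single j (EuclideanSpace.single a 1)

/-- The classical partial derivative in the `a`-th coordinate of the `j`-th particle. -/
def partialDeriv {N : ℕ} (j : Fin N) (a : Fin 2) (φ : Config N → ℂ) (x : Config N) : ℂ :=
  fderiv ℝ φ x (unitVec j a)

/-- The `a`-th component of `D_j φ = (-i ∇_{x_j} + α A_j) φ`. -/
def magneticDeriv {N : ℕ} (α : ℝ) (j : Fin N) (a : Fin 2) (φ : Config N → ℂ) (x : Config N) : ℂ :=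
  -Complex.I * partialDeriv j a φ x + ((α * vectorPotential j x a : ℝ) : ℂ) * φ x

/-- The core: smooth functions, invariant under permutations of the particles, whose support is a
compact subset of the complement of the diagonals. -/
structure IsCore {N : ℕ} (φ : Config N → ℂ) : Prop where
  smooth : ContDiff ℝ ∞ φ
  compact : HasCompactSupport φ
  support : tsupport φ ⊆ (diagonal N)ᶜ
  symm : ∀ (σ : Equiv.Perm (Fin N)) (x : Config N), φ (x ∘ σ) = φ x

/-- The quadratic form `∑_j ∫ (|D_j φ|² + V_ε(x_j) |φ|²)`, to be used on the core. -/
def energy {N : ℕ} (α ε : ℝ) (φ : Config N → ℂ) : ℝ :=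
  ∑ j : Fin N, ∫ x, ((∑ a : Fin 2, ‖magneticDeriv α j a φ x‖ ^ 2) + trap ε (x j) * ‖φ x‖ ^ 2)

/-- The differential operator `∑_j (D_j² + V_ε(x_j))`, to be used on the core. -/
def hamiltonian {N : ℕ} (α ε : ℝ) (φ : Config N → ℂ) (x : Config N) : ℂ :=
  ∑ j : Fin N, ((∑ a : Fin 2, magneticDeriv α j a (magneticDeriv α j a φ) x)
    + (trap ε (x j) : ℂ) * φ x)

/-- The domain of the closure of the quadratic form `energy α ε` on the core: the `L²`-limits of
sequences in the core that are Cauchy for the form norm. -/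
def formDomain (N : ℕ) (α ε : ℝ) : Set (L2 N) :=
  {φ | ∃ u : ℕ → Config N → ℂ, (∀ n, IsCore (u n)) ∧
    (∀ δ > 0, ∃ n₀, ∀ m ≥ n₀, ∀ n ≥ n₀, energy α ε (u m - u n) < δ) ∧
    Tendsto (fun n => eLpNorm (fun x => u n x - φ x) 2 volume) atTop (𝓝 0)}

/-- `g` is the weak (distributional) partial derivative of `φ` in the `a`-th coordinate of the
`j`-th particle, on all of `ℝ^{2N}`. -/
def IsWeakPartial {N : ℕ} (j : Fin N) (a : Fin 2) (φ g : L2 N) : Prop :=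
  ∀ ψ : Config N → ℂ, ContDiff ℝ ∞ ψ → HasCompactSupport ψ →
    ∫ x, φ x * partialDeriv j a ψ x = -∫ x, g x * ψ x

/-- The Sobolev space `H¹(ℝ^{2N})`. -/
def sobolevH1 (N : ℕ) : Set (L2 N) :=
  {φ | ∀ (j : Fin N) (a : Fin 2), ∃ g : L2 N, IsWeakPartial j a φ g}

/-- `H¹_V(ℝ^{2N})`: the `φ ∈ H¹(ℝ^{2N})` with `|x_j| φ ∈ L²` for all `j`. -/
def sobolevH1V (N : ℕ) : Set (L2 N) :=
  {φ | φ ∈ sobolevH1 N ∧ ∀ j : Fin N, MemLp (fun x => (‖x j‖ : ℂ) * φ x) 2 volume}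

theorem measurePreserving_perm {N : ℕ} (σ : Equiv.Perm (Fin N)) :
    MeasurePreserving (fun x : Config N => x ∘ σ) volume volume := by
  convert volume_measurePreserving_piCongrLeft (fun _ : Fin N => Plane) σ.symm using 1
  funext x i
  simp [MeasurableEquiv.coe_piCongrLeft, Equiv.piCongrLeft, Equiv.piCongrLeft']

/-- `L²_sym(ℝ^{2N})`: the square-integrable functions that are invariant under permutations of the
particles. -/
def L2sym (N : ℕ) : Submodule ℂ (L2 N) where
  carrier := {φ | ∀ σ : Equiv.Perm (Fin N), (fun x => φ (x ∘ σ)) =ᵐ[volume] φ}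
  zero_mem' := by
    intro σ
    have h := Lp.coeFn_zero ℂ 2 (volume : Measure (Config N))
    filter_upwards [h, (measurePreserving_perm σ).quasiMeasurePreserving.ae_eq_comp h]
      with x h1 h2
    exact h2.trans h1.symm
  add_mem' := by
    intro φ ψ hφ hψ σ
    have h := Lp.coeFn_add φ ψ
    filter_upwards [h, (measurePreserving_perm σ).quasiMeasurePreserving.ae_eq_comp h,
      hφ σ, hψ σ] with x h1 h2 h3 h4
    simp only [Function.comp_apply, Pi.add_apply] at h1 h2 h3 h4 ⊢
    rw [h1, h2, h3, h4]
  smul_mem' := by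
    intro c φ hφ σ
    have h := Lp.coeFn_smul c φ
    filter_upwards [h, (measurePreserving_perm σ).quasiMeasurePreserving.ae_eq_comp h, hφ σ]
      with x h1 h2 h3
    simp only [Function.comp_apply, Pi.smul_apply] at h1 h2 h3 ⊢
    rw [h1, h2, h3]

/-- The graph `{(φ, H φ)}` of the Friedrichs extension `H` of `hamiltonian α ε` on the core: the
restriction of the adjoint of this symmetric operator on `L²_sym` to the form domain. -/
def friedrichsGraph (N : ℕ) (α ε : ℝ) : Set (L2sym N × L2sym N) :=
  {p | (p.1 : L2 N) ∈ formDomain N α ε ∧ ∀ v : Config N → ℂ, IsCore v →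
    ∫ x, conj ((p.1 : L2 N) x) * hamiltonian α ε v x = ∫ x, conj ((p.2 : L2 N) x) * v x}

/-- `R` is the inverse of `H + 1`, where `H` is the operator with the given graph: for all `φ`
and `f`, `φ` is in the domain of `H` with `H φ + φ = f` if and only if `φ = R f`. -/
def IsResolventAtNegOne {N : ℕ} (graph : Set (L2sym N × L2sym N))
    (R : L2sym N →L[ℂ] L2sym N) : Prop :=
  ∀ φ f : L2sym N, (φ, f - φ) ∈ graph ↔ φ = R f

end Anyon

end

/-! Everything rests on a Hardy inequality: when α is not an even integer, the magnetic kinetic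
energy of a symmetric core function bounds ∫ |x_j - x_k|⁻² |φ|² for every pair
(`lintegral_inv_norm_sub_sq_le`). Since A_j is controlled by the inverse distances, α A_j φ is then
bounded in L², and so is ∇φ (`exists_integral_partialDeriv_sq_le`). For α = 0 the magnetic gradient
is the gradient up to the factor -i, and nothing is needed.

For the Hardy inequality, the configurations are split according to whether a third particle lies in
the closed disc with diameter x_j x_k. If none does, rotate the pair about its centre. The half-turn
exchanges the two particles, so φ returns to its value, while the gauge phase that removes the
potential along the path grows by exactly απ: the pair contributes its own angle, and particles
outside the disc have no winding. The gauged function is therefore multiplied by e^{iαπ} ≠ 1 over a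
half-turn, and a function of this kind is controlled by its derivative
(`integral_norm_sq_le_of_twisted_periodic`). Rotations preserve Lebesgue measure, so averaging over
the angle gives the integral inequality (`lintegral_pairAlone_le`). If a third particle l is in the
disc, |x_j - x_k|² is comparable with the sum ρ² of the squared distances of the triple. The
relative motion of three particles is four-dimensional, where the Hardy inequality with weight ρ⁻²
holds for every α, because real vector potentials drop out (`lintegral_tripleSq_inv_le`).

For the operator, the core is embedded in a finite sum of copies of L² by u ↦ (u, D u, scaled
coordinates times u), whose squared norm is ‖u‖² plus the energy. The first components of the
closure of the range form the form domain (`mem_formDomain_iff`). Orthogonal projection onto this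
closure solves the weak form of (H + 1)φ = f and gives the resolvent
(`isResolvent_friedrichsResolvent`).

Compactness is a Rellich argument: averaging over finitely many small cubes has finite rank and
approximates a function in L² with an error controlled by its gradient and its second moments
(`exists_compact_approx`). Both are controlled by the form norm, so the resolvent is a norm limit of
compact operators. The same gradient bound makes the derivatives of core approximants Cauchy, which
gives the Sobolev inclusion. -/

noncomputable section

namespace Anyon

variable {N : ℕ}

/-! ### Calculus of test functions supported away from the collisions -/

/-- Smooth functions whose support is a compact subset of the complement of the diagonals. -/
structure IsTest (φ : Config N → ℂ) : Prop where
  smooth : ContDiff ℝ ∞ φ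
  compact : HasCompactSupport φ
  support : tsupport φ ⊆ (diagonal N)ᶜ

theorem IsCore.isTest {φ : Config N → ℂ} (h : IsCore φ) : IsTest φ :=
  ⟨h.smooth, h.compact, h.support⟩

theorem IsTest.of_tsupport_subset {φ ψ : Config N → ℂ} (h : IsTest φ) (hψ : ContDiff ℝ ∞ ψ)
    (hs : tsupport ψ ⊆ tsupport φ) : IsTest ψ :=
  ⟨hψ, h.compact.isCompact.of_isClosed_subset (isClosed_tsupport _) hs, hs.trans h.support⟩

theorem IsTest.continuous {φ : Config N → ℂ} (h : IsTest φ) : Continuous φ := h.smooth.continuous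

theorem IsTest.differentiable {φ : Config N → ℂ} (h : IsTest φ) : Differentiable ℝ φ :=
  h.smooth.differentiable (by simp)

theorem IsTest.memLp {φ : Config N → ℂ} (h : IsTest φ) : MemLp φ 2 volume :=
  h.continuous.memLp_of_hasCompactSupport h.compact

theorem IsTest.add {φ ψ : Config N → ℂ} (hφ : IsTest φ) (hψ : IsTest ψ) : IsTest (φ + ψ) :=
  ⟨hφ.smooth.add hψ.smooth, hφ.compact.add hψ.compact,
    (tsupport_add φ ψ).trans (Set.union_subset hφ.support hψ.support)⟩

/-- Near a point outside the support of `φ` the product vanishes identically, so singularities of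
`g` on the diagonals do no harm. -/
theorem IsTest.mul_left {φ g : Config N → ℂ} (h : IsTest φ)
    (hg : ∀ x ∉ diagonal N, ContDiffAt ℝ ∞ g x) : IsTest (fun x => g x * φ x) := by
  refine h.of_tsupport_subset ?_ tsupport_mul_subset_right
  rw [contDiff_iff_contDiffAt]
  intro x
  by_cases hx : x ∈ tsupport φ
  · exact (hg x (h.support hx)).mul h.smooth.contDiffAt
  · have h0 : (fun x => g x * φ x) =ᶠ[𝓝 x] fun _ => 0 := by
      filter_upwards [notMem_tsupport_iff_eventuallyEq.1 hx] with y hy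
      simp [hy]
    exact contDiffAt_const.congr_of_eventuallyEq h0

theorem IsTest.const_mul {φ : Config N → ℂ} (h : IsTest φ) (c : ℂ) : IsTest (fun x => c * φ x) :=
  h.mul_left fun _ _ => contDiffAt_const

theorem IsTest.partialDeriv {φ : Config N → ℂ} (h : IsTest φ) (j : Fin N) (a : Fin 2) :
    IsTest (partialDeriv j a φ) := by
  refine h.of_tsupport_subset ?_ (tsupport_fderiv_apply_subset ℝ _)
  exact (h.smooth.fderiv_right (m := ∞) (by simp)).clm_apply contDiff_const

theorem partialDeriv_add {φ ψ : Config N → ℂ} (hφ : IsTest φ) (hψ : IsTest ψ) (j : Fin N)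
    (a : Fin 2) : partialDeriv j a (φ + ψ) = partialDeriv j a φ + partialDeriv j a ψ := by
  funext x
  simp only [Anyon.partialDeriv, Pi.add_apply]
  rw [fderiv_add (hφ.differentiable x) (hψ.differentiable x)]
  rfl

theorem partialDeriv_const_smul {φ : Config N → ℂ} (hφ : IsTest φ) (c : ℂ) (j : Fin N)
    (a : Fin 2) : partialDeriv j a (c • φ) = c • partialDeriv j a φ := by
  funext x
  simp only [Anyon.partialDeriv, Pi.smul_apply]
  rw [fderiv_const_smul (hφ.differentiable x)]
  rfl

theorem perp_zero_apply (v : Plane) : perp v 0 = -v 1 := by simp [perp]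

theorem perp_one_apply (v : Plane) : perp v 1 = v 0 := by simp [perp]

theorem vectorPotential_apply (j : Fin N) (a : Fin 2) (x : Config N) :
    vectorPotential j x a = ∑ k ∈ Finset.univ.erase j,
      (‖x j - x k‖ ^ 2)⁻¹ * perp (x j - x k) a := by
  simp [vectorPotential]

theorem contDiff_coord (j : Fin N) (a : Fin 2) : ContDiff ℝ ∞ (fun x : Config N => x j a) :=
  (EuclideanSpace.proj a : Plane →L[ℝ] ℝ).contDiff.comp (contDiff_apply ℝ Plane j)

theorem contDiff_perp_coord (j k : Fin N) (a : Fin 2) :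
    ContDiff ℝ ∞ (fun x : Config N => perp (x j - x k) a) := by
  fin_cases a
  · simpa [perp_zero_apply] using (contDiff_coord k 1).sub (contDiff_coord j 1)
  · simpa [perp_one_apply] using (contDiff_coord j 0).sub (contDiff_coord k 0)

theorem contDiff_norm_sub_sq (j k : Fin N) :
    ContDiff ℝ ∞ (fun x : Config N => ‖x j - x k‖ ^ 2) :=
  ((contDiff_apply ℝ Plane j).sub (contDiff_apply ℝ Plane k)).norm_sq ℝ

theorem contDiffAt_vectorPotential (j : Fin N) (a : Fin 2) {x : Config N} (hx : x ∉ diagonal N) :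
    ContDiffAt ℝ ∞ (fun x => vectorPotential j x a) x := by
  simp only [vectorPotential_apply]
  refine ContDiffAt.sum fun k hk => ?_
  have hne : x j ≠ x k := fun h => hx ⟨j, k, (Finset.ne_of_mem_erase hk).symm, h⟩
  refine ((contDiff_norm_sub_sq j k).contDiffAt.inv ?_).mul (contDiff_perp_coord j k a).contDiffAt
  exact pow_ne_zero 2 (norm_ne_zero_iff.2 (sub_ne_zero.2 hne))

theorem IsTest.vectorPotential_mul {φ : Config N → ℂ} (h : IsTest φ) (α : ℝ) (j : Fin N)
    (a : Fin 2) : IsTest (fun x => ((α * vectorPotential j x a : ℝ) : ℂ) * φ x) :=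
  h.mul_left fun _ hx => Complex.ofRealCLM.contDiff.contDiffAt.comp _
    (contDiffAt_const.mul (contDiffAt_vectorPotential j a hx))

/-- A single component of D_j is not permutation invariant, so `IsCore` is not stable under it;
`IsTest` drops the symmetry so that magnetic derivatives can be iterated. -/
theorem IsTest.magneticDeriv {φ : Config N → ℂ} (h : IsTest φ) (α : ℝ) (j : Fin N) (a : Fin 2) :
    IsTest (magneticDeriv α j a φ) :=
  ((h.partialDeriv j a).const_mul (-Complex.I)).add (h.vectorPotential_mul α j a)

theorem magneticDeriv_add {φ ψ : Config N → ℂ} (hφ : IsTest φ) (hψ : IsTest ψ) (α : ℝ) (j : Fin N)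
    (a : Fin 2) : magneticDeriv α j a (φ + ψ) = magneticDeriv α j a φ + magneticDeriv α j a ψ := by
  funext x
  simp only [Anyon.magneticDeriv, partialDeriv_add hφ hψ, Pi.add_apply]
  ring

theorem magneticDeriv_const_smul {φ : Config N → ℂ} (hφ : IsTest φ) (c : ℂ) (α : ℝ) (j : Fin N)
    (a : Fin 2) : magneticDeriv α j a (c • φ) = c • magneticDeriv α j a φ := by
  funext x
  simp only [Anyon.magneticDeriv, partialDeriv_const_smul hφ, Pi.smul_apply, smul_eq_mul]
  ring

theorem IsTest.coord_mul {φ : Config N → ℂ} (h : IsTest φ) (c : ℝ) (j : Fin N)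
    (a : Fin 2) : IsTest (fun x => ((c * x j a : ℝ) : ℂ) * φ x) :=
  h.mul_left fun _ _ => Complex.ofRealCLM.contDiff.contDiffAt.comp _
    (contDiffAt_const.mul (contDiff_coord j a).contDiffAt)

theorem IsTest.integrable_mul {φ g : Config N → ℂ} (h : IsTest φ) (hg : Continuous g) :
    Integrable (fun x => g x * φ x) :=
  (hg.mul h.continuous).integrable_of_hasCompactSupport h.compact.mul_left

theorem IsTest.integrable_norm_sq {φ : Config N → ℂ} (h : IsTest φ) {g : Config N → ℝ}
    (hg : Continuous g) : Integrable (fun x => g x * ‖φ x‖ ^ 2) := by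
  refine (hg.mul (h.continuous.norm.pow 2)).integrable_of_hasCompactSupport ?_
  have h2 : HasCompactSupport (fun x => ‖φ x‖ ^ 2) :=
    h.compact.comp_left (g := fun z : ℂ => ‖z‖ ^ 2) (by simp)
  exact h2.mul_left

/-- Integration by parts for a test function against a smooth function. -/

theorem IsTest.integral_mul_partialDeriv {φ ψ : Config N → ℂ} (hφ : IsTest φ)
    (hψ : ContDiff ℝ ∞ ψ) (j : Fin N) (a : Fin 2) :
    ∫ x, φ x * Anyon.partialDeriv j a ψ x = -∫ x, Anyon.partialDeriv j a φ x * ψ x := by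
  have hψ' : Continuous (Anyon.partialDeriv j a ψ) :=
    ((hψ.fderiv_right (m := ∞) (by simp)).clm_apply contDiff_const).continuous
  refine integral_mul_fderiv_eq_neg_fderiv_mul_of_integrable ?_ ?_ ?_
    (fun x _ => hφ.differentiable x) (fun x _ => hψ.differentiable (by simp) x)
  · exact ((hφ.partialDeriv j a).integrable_mul hψ.continuous).congr
      (Eventually.of_forall fun x => mul_comm _ _)
  · exact (hφ.integrable_mul hψ').congr (Eventually.of_forall fun x => mul_comm _ _)
  · simpa only [mul_comm] using hφ.integrable_mul hψ.continuous

theorem partialDeriv_conj {φ : Config N → ℂ} (hφ : IsTest φ) (j : Fin N) (a : Fin 2)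
    (x : Config N) :
    partialDeriv j a (fun y => conj (φ y)) x = conj (partialDeriv j a φ x) := by
  have h := (Complex.conjCLE.toContinuousLinearMap.hasFDerivAt (x := φ x)).comp x
    (hφ.differentiable x).hasFDerivAt
  have h' : HasFDerivAt (fun y => conj (φ y)) _ x := h
  simp only [Anyon.partialDeriv, h'.fderiv]
  simp

/-- The components of `D_j` are symmetric on test functions. -/

theorem IsTest.integral_conj_magneticDeriv {φ ψ : Config N → ℂ} (hφ : IsTest φ) (hψ : IsTest ψ)
    (α : ℝ) (j : Fin N) (a : Fin 2) :
    ∫ x, conj (Anyon.magneticDeriv α j a φ x) * ψ x =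
      ∫ x, conj (φ x) * Anyon.magneticDeriv α j a ψ x := by
  have hc : ContDiff ℝ ∞ (fun y => conj (φ y)) :=
    Complex.conjCLE.toContinuousLinearMap.contDiff.comp hφ.smooth
  have hc' : Continuous (fun y => conj (Anyon.partialDeriv j a φ y)) :=
    Complex.continuous_conj.comp (hφ.partialDeriv j a).continuous
  have key := hψ.integral_mul_partialDeriv hc j a
  simp only [partialDeriv_conj hφ] at key
  have i1 : Integrable fun x => Complex.I * conj (Anyon.partialDeriv j a φ x) * ψ x :=
    hψ.integrable_mul (continuous_const.mul hc')
  have i2 := (hψ.vectorPotential_mul α j a).integrable_mul hc.continuous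
  have i3 : Integrable fun x => -Complex.I * conj (φ x) * Anyon.partialDeriv j a ψ x :=
    (hψ.partialDeriv j a).integrable_mul (continuous_const.mul hc.continuous)
  have e1 : ∀ x, conj (Anyon.magneticDeriv α j a φ x) * ψ x =
      Complex.I * conj (Anyon.partialDeriv j a φ x) * ψ x +
        conj (φ x) * (((α * vectorPotential j x a : ℝ) : ℂ) * ψ x) := by
    intro x
    simp only [Anyon.magneticDeriv, map_add, map_mul, map_neg, Complex.conj_I, Complex.conj_ofReal]
    ring
  have e2 : ∀ x, conj (φ x) * Anyon.magneticDeriv α j a ψ x =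
      -Complex.I * conj (φ x) * Anyon.partialDeriv j a ψ x +
        conj (φ x) * (((α * vectorPotential j x a : ℝ) : ℂ) * ψ x) := by
    intro x
    simp only [Anyon.magneticDeriv]
    ring
  simp only [e1, e2]
  rw [integral_add i1 i2, integral_add i3 i2]
  congr 1
  have f1 : ∀ x, Complex.I * conj (Anyon.partialDeriv j a φ x) * ψ x =
      Complex.I * (ψ x * conj (Anyon.partialDeriv j a φ x)) := fun x => by ring
  have f2 : ∀ x, -Complex.I * conj (φ x) * Anyon.partialDeriv j a ψ x =
      -Complex.I * (Anyon.partialDeriv j a ψ x * conj (φ x)) := fun x => by ring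
  simp only [f1, f2]
  rw [integral_const_mul, integral_const_mul, key]
  ring

/-! ### Hardy's inequality for three particles -/

/-- For a real `C¹` function `F`, the inequality `|D φ - i F φ|² ≥ 0` integrated by parts. -/

theorem IsTest.integral_deriv_sub_sq_le {φ : Config N → ℂ} (hφ : IsTest φ) {F : Config N → ℝ}
    (hF : ContDiff ℝ 1 F) (α : ℝ) (j : Fin N) (a : Fin 2) :
    ∫ x, (fderiv ℝ F x (unitVec j a) - F x ^ 2) * ‖φ x‖ ^ 2 ≤
      ∫ x, ‖Anyon.magneticDeriv α j a φ x‖ ^ 2 := by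
  set D := Anyon.magneticDeriv α j a φ with hD
  set P := Anyon.partialDeriv j a φ with hP
  have hDt : IsTest D := hφ.magneticDeriv α j a
  have hF' : Continuous (fun x => fderiv ℝ F x (unitVec j a)) :=
    (hF.continuous_fderiv (by simp)).clm_apply continuous_const
  have hsqf : ∀ x, HasFDerivAt (fun x => ‖φ x‖ ^ 2)
      (2 • (innerSL ℝ (φ x)).comp (fderiv ℝ φ x)) x :=
    fun x => (hφ.differentiable x).hasFDerivAt.norm_sq
  have hsq : ∀ x, fderiv ℝ (fun x => ‖φ x‖ ^ 2) x (unitVec j a) = 2 * (P x * conj (φ x)).re := by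
    intro x
    rw [(hsqf x).fderiv]
    simp [hP, Anyon.partialDeriv, Complex.inner]
    ring
  -- The potential is real, so it adds a purely imaginary term and the real part does not see α.
  have hg : ∀ x, (P x * conj (φ x)).re = (Complex.I * D x * conj (φ x)).re := by
    intro x
    have : Complex.I * D x * conj (φ x) = P x * conj (φ x) +
        Complex.I * ((α * vectorPotential j x a * Complex.normSq (φ x) : ℝ) : ℂ) := by
      simp only [hD, Anyon.magneticDeriv, ← hP]
      push_cast
      rw [Complex.normSq_eq_conj_mul_self]
      linear_combination (-(P x * conj (φ x))) * Complex.I_mul_I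
    rw [this, Complex.add_re, Complex.re_mul_ofReal]
    simp
  have i1 : Integrable (fun x => fderiv ℝ F x (unitVec j a) * ‖φ x‖ ^ 2) :=
    hφ.integrable_norm_sq hF'
  have i2 : Integrable (fun x => F x ^ 2 * ‖φ x‖ ^ 2) :=
    hφ.integrable_norm_sq (hF.continuous.pow 2)
  have i3 : Integrable (fun x => ‖D x‖ ^ 2) := by
    simpa using hDt.integrable_norm_sq (continuous_const (y := (1 : ℝ)))
  have i4 : Integrable (fun x => F x * (2 * (P x * conj (φ x)).re)) := by
    have hc : Continuous (fun y => (F y : ℂ) * (2 * conj (φ y))) :=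
      (Complex.continuous_ofReal.comp hF.continuous).mul
        (continuous_const.mul (Complex.continuous_conj.comp hφ.continuous))
    have := ((hφ.partialDeriv j a).integrable_mul hc).re
    refine this.congr (Eventually.of_forall fun x => ?_)
    have : (F x : ℂ) * (2 * conj (φ x)) * Anyon.partialDeriv j a φ x =
      ((F x * 2 : ℝ) : ℂ) * (P x * conj (φ x)) := by
      push_cast
      ring
    simp only [this]
    rw [RCLike.re_eq_complex_re, Complex.re_ofReal_mul]
    ring
  have ibp : ∫ x, F x * fderiv ℝ (fun x => ‖φ x‖ ^ 2) x (unitVec j a) =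
      -∫ x, fderiv ℝ F x (unitVec j a) * ‖φ x‖ ^ 2 := by
    refine integral_mul_fderiv_eq_neg_fderiv_mul_of_integrable i1 ?_ ?_
      (fun x _ => hF.differentiable (by simp) x) (fun x _ => (hsqf x).differentiableAt)
    · simpa only [hsq] using i4
    · exact hφ.integrable_norm_sq hF.continuous
  simp only [hsq] at ibp
  have hsplit : ∫ x, (fderiv ℝ F x (unitVec j a) - F x ^ 2) * ‖φ x‖ ^ 2 =
      ∫ x, (-(F x * (2 * (P x * conj (φ x)).re)) - F x ^ 2 * ‖φ x‖ ^ 2) := by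
    have i4' : Integrable fun x => -(F x * (2 * (P x * conj (φ x)).re)) := i4.neg
    rw [integral_sub i4' i2, integral_neg, ibp, neg_neg, ← integral_sub i1 i2]
    simp only [sub_mul]
  rw [hsplit]
  -- Pointwise this is Young's inequality -2 F Re(i D φ̄) ≤ F² |φ|² + |D|², with `D` standing for
  -- the magnetic derivative.
  refine integral_mono (i4.neg.sub i2) i3 fun x => ?_
  have h1 : |(Complex.I * D x * conj (φ x)).re| ≤ ‖D x‖ * ‖φ x‖ := by
    refine (Complex.abs_re_le_norm _).trans ?_
    simp
  simp only [hg]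
  have h2 := abs_le.1 h1
  nlinarith [sq_nonneg (‖D x‖ - |F x| * ‖φ x‖), sq_abs (F x), abs_nonneg (F x),
    abs_mul (F x) (Complex.I * D x * conj (φ x)).re,
    neg_abs_le (F x * (Complex.I * D x * conj (φ x)).re),
    mul_le_mul_of_nonneg_left h1 (abs_nonneg (F x))]

theorem unitVec_apply (j : Fin N) (a : Fin 2) (i : Fin N) (b : Fin 2) :
    (unitVec j a : Config N) i b = if i = j then (if b = a then 1 else 0) else 0 := by
  by_cases h : i = j
  · subst h
    simp [unitVec]
  · simp [unitVec, h]

/-- The kinetic energy `∑_j ∫ |D_j φ|²`. -/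

def kinetic (α : ℝ) (φ : Config N → ℂ) : ℝ :=
  ∑ j : Fin N, ∑ a : Fin 2, ∫ x, ‖magneticDeriv α j a φ x‖ ^ 2

/-- The sum of the squared distances between three particles. -/

def tripleSq (m p q : Fin N) (x : Config N) : ℝ :=
  ‖x m - x p‖ ^ 2 + ‖x p - x q‖ ^ 2 + ‖x q - x m‖ ^ 2

theorem tripleSq_nonneg (m p q : Fin N) (x : Config N) : 0 ≤ tripleSq m p q x := by
  unfold tripleSq
  positivity

theorem tripleSq_rotate (m p q : Fin N) (x : Config N) : tripleSq p q m x = tripleSq m p q x := by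
  unfold tripleSq
  ring

theorem contDiff_tripleSq (m p q : Fin N) : ContDiff ℝ ∞ (tripleSq m p q) :=
  ((contDiff_norm_sub_sq m p).add (contDiff_norm_sub_sq p q)).add (contDiff_norm_sub_sq q m)

/-- Half of the derivative of `tripleSq m p q` in the `a`-th coordinate of the particle `m`. -/

def tripleGrad (m p q : Fin N) (a : Fin 2) (x : Config N) : ℝ := 2 * x m a - x p a - x q a

theorem sum_tripleGrad_sq (m p q : Fin N) (x : Config N) :
    ∑ a, (tripleGrad m p q a x ^ 2 + tripleGrad p q m a x ^ 2 + tripleGrad q m p a x ^ 2) =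
      3 * tripleSq m p q x := by
  simp only [tripleGrad, tripleSq, EuclideanSpace.norm_sq_eq, Fin.sum_univ_two, Real.norm_eq_abs,
    sq_abs, PiLp.sub_apply]
  ring

theorem contDiff_tripleGrad (m p q : Fin N) (a : Fin 2) : ContDiff ℝ ∞ (tripleGrad m p q a) :=
  ((contDiff_const.mul (contDiff_coord m a)).sub (contDiff_coord p a)).sub (contDiff_coord q a)

theorem tripleSq_add_smul_unitVec {m p q : Fin N} (hp : p ≠ m) (hq : q ≠ m) (a : Fin 2)
    (x : Config N) (t : ℝ) : tripleSq m p q (x + t • unitVec m a) =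
      tripleSq m p q x + 2 * t * tripleGrad m p q a x + 2 * t ^ 2 := by
  simp only [tripleGrad, tripleSq, EuclideanSpace.norm_sq_eq, Fin.sum_univ_two, Real.norm_eq_abs,
    sq_abs, PiLp.sub_apply, Pi.add_apply, Pi.smul_apply, PiLp.add_apply, PiLp.smul_apply,
    unitVec_apply, hp, hq, if_true, if_false, smul_eq_mul]
  fin_cases a <;> simp <;> ring

theorem tripleGrad_add_smul_unitVec {m p q : Fin N} (hp : p ≠ m) (hq : q ≠ m) (a : Fin 2)
    (x : Config N) (t : ℝ) : tripleGrad m p q a (x + t • unitVec m a) =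
      tripleGrad m p q a x + 2 * t := by
  simp only [tripleGrad, Pi.add_apply, Pi.smul_apply, PiLp.add_apply, PiLp.smul_apply,
    unitVec_apply, hp, hq, if_true, if_false, smul_eq_mul]
  ring

/-- The vector field `∇ρ² / (2 (ρ² + δ))`, where `ρ²` is `tripleSq`. -/

def tripleField (m p q : Fin N) (a : Fin 2) (δ : ℝ) (x : Config N) : ℝ :=
  tripleGrad m p q a x / (tripleSq m p q x + δ)

theorem contDiff_tripleField (m p q : Fin N) (a : Fin 2) {δ : ℝ} (hδ : 0 < δ) :
    ContDiff ℝ ∞ (tripleField m p q a δ) :=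
  (contDiff_tripleGrad m p q a).div ((contDiff_tripleSq m p q).add contDiff_const)
    fun x => by have := tripleSq_nonneg m p q x; positivity

theorem fderiv_tripleField {m p q : Fin N} (hp : p ≠ m) (hq : q ≠ m) (a : Fin 2) {δ : ℝ}
    (hδ : 0 < δ) (x : Config N) : fderiv ℝ (tripleField m p q a δ) x (unitVec m a) =
      2 / (tripleSq m p q x + δ) - 2 * tripleGrad m p q a x ^ 2 / (tripleSq m p q x + δ) ^ 2 := by
  have hs : tripleSq m p q x + δ ≠ 0 := by
    have := tripleSq_nonneg m p q x
    positivity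
  rw [← ((contDiff_tripleField m p q a hδ).differentiable (by simp) x).lineDeriv_eq_fderiv,
    lineDeriv]
  simp only [tripleField, tripleSq_add_smul_unitVec hp hq, tripleGrad_add_smul_unitVec hp hq]
  have h1 : HasDerivAt (fun t : ℝ => tripleGrad m p q a x + 2 * t) 2 0 := by
    simpa using ((hasDerivAt_id (0 : ℝ)).const_mul 2).const_add (tripleGrad m p q a x)
  have h2 : HasDerivAt (fun t : ℝ => tripleSq m p q x + 2 * t * tripleGrad m p q a x + 2 * t ^ 2
      + δ) (2 * tripleGrad m p q a x) 0 := by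
    have e1 := (((hasDerivAt_id (0 : ℝ)).const_mul 2).mul_const (tripleGrad m p q a x)).const_add
      (tripleSq m p q x)
    have e2 := ((hasDerivAt_id (0 : ℝ)).pow 2).const_mul 2
    simpa using (e1.add e2).add_const δ
  have h3 := h1.div h2 (by simpa using hs)
  refine h3.deriv.trans ?_
  simp only [mul_zero, zero_mul, add_zero, ne_eq, OfNat.ofNat_ne_zero, not_false_eq_true, zero_pow]
  field_simp

/-- The coefficient 3 collects 2 from the derivative of the field and 1 from its square. -/
theorem integral_field_le {φ : Config N → ℂ} (hφ : IsTest φ) (α : ℝ) {m p q : Fin N} (hp : p ≠ m)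
    (hq : q ≠ m) (a : Fin 2) {δ : ℝ} (hδ : 0 < δ) :
    ∫ x, (2 / (tripleSq m p q x + δ) - 3 * tripleGrad m p q a x ^ 2 / (tripleSq m p q x + δ) ^ 2)
      * ‖φ x‖ ^ 2 ≤ ∫ x, ‖magneticDeriv α m a φ x‖ ^ 2 := by
  refine le_trans (le_of_eq ?_) (hφ.integral_deriv_sub_sq_le
    ((contDiff_tripleField m p q a hδ).of_le (by simp)) α m a)
  congr 1
  funext x
  rw [fderiv_tripleField hp hq a hδ, tripleField, div_pow]
  ring

theorem sum_triple_le_kinetic (α : ℝ) (φ : Config N → ℂ) {j k l : Fin N} (hjk : j ≠ k)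
    (hkl : k ≠ l) (hlj : l ≠ j) :
    ∑ a, ((∫ x, ‖magneticDeriv α j a φ x‖ ^ 2) + (∫ x, ‖magneticDeriv α k a φ x‖ ^ 2) +
      ∫ x, ‖magneticDeriv α l a φ x‖ ^ 2) ≤ kinetic α φ := by
  have h : ∑ i ∈ ({j, k, l} : Finset (Fin N)), ∑ a : Fin 2, ∫ x, ‖magneticDeriv α i a φ x‖ ^ 2 ≤
      kinetic α φ :=
    Finset.sum_le_sum_of_subset_of_nonneg (Finset.subset_univ _) fun i _ _ =>
      Finset.sum_nonneg fun a _ => integral_nonneg fun x => by positivity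
  rw [Finset.sum_insert (by simp [hjk, hlj.symm]), Finset.sum_insert (by simp [hkl]),
    Finset.sum_singleton, ← Finset.sum_add_distrib, ← Finset.sum_add_distrib] at h
  simpa only [add_assoc] using h

theorem integral_tripleSq_add_inv_le {φ : Config N → ℂ} (hφ : IsTest φ) (α : ℝ) {j k l : Fin N}
    (hjk : j ≠ k) (hkl : k ≠ l) (hlj : l ≠ j) {δ : ℝ} (hδ : 0 < δ) :
    ∫ x, 3 * (tripleSq j k l x + δ)⁻¹ * ‖φ x‖ ^ 2 ≤ kinetic α φ := by
  refine le_trans ?_ (sum_triple_le_kinetic α φ hjk hkl hlj)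
  have hpos : ∀ x, 0 < tripleSq j k l x + δ := fun x => by
    have := tripleSq_nonneg j k l x
    positivity
  have hc0 : Continuous fun x => tripleSq j k l x + δ :=
    (contDiff_tripleSq j k l).continuous.add continuous_const
  have hint : ∀ (m p q : Fin N) (a : Fin 2), Integrable (fun x =>
      (2 / (tripleSq j k l x + δ) - 3 * tripleGrad m p q a x ^ 2 / (tripleSq j k l x + δ) ^ 2)
      * ‖φ x‖ ^ 2) := fun m p q a => by
    have hg := (contDiff_tripleGrad m p q a).continuous
    refine hφ.integrable_norm_sq ((continuous_const.div hc0 fun x => (hpos x).ne').sub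
      ((continuous_const.mul (hg.pow 2)).div (hc0.pow 2) fun x => pow_ne_zero 2 (hpos x).ne'))
  have h1 := fun a => integral_field_le hφ α hjk.symm hlj a hδ
  have h2 := fun a => integral_field_le hφ α hkl.symm hjk a hδ
  have h3 := fun a => integral_field_le hφ α hlj.symm hkl a hδ
  simp only [tripleSq_rotate j k l] at h2
  have hrot : ∀ x, tripleSq l j k x = tripleSq j k l x := fun x => by
    rw [← tripleSq_rotate l j k]
  simp only [hrot] at h3
  refine le_trans ?_ (Finset.sum_le_sum fun a _ => add_le_add (add_le_add (h1 a) (h2 a)) (h3 a))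
  set g : Fin N → Fin N → Fin N → Fin 2 → Config N → ℝ := fun m p q a x =>
    (2 / (tripleSq j k l x + δ) - 3 * tripleGrad m p q a x ^ 2 / (tripleSq j k l x + δ) ^ 2)
      * ‖φ x‖ ^ 2 with hg
  have hint2 : ∀ a, Integrable fun x => g j k l a x + g k l j a x :=
    fun a => (hint j k l a).add (hint k l j a)
  have hint3 : ∀ a, Integrable fun x => g j k l a x + g k l j a x + g l j k a x :=
    fun a => (hint2 a).add (hint l j k a)
  have e : ∀ a, ∫ x, (g j k l a x + g k l j a x + g l j k a x) =
      (∫ x, g j k l a x) + (∫ x, g k l j a x) + ∫ x, g l j k a x := fun a => by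
    rw [integral_add (hint2 a) (hint l j k a), integral_add (hint j k l a) (hint k l j a)]
  refine le_trans ?_ (Finset.sum_le_sum fun a _ => (e a).le)
  rw [← integral_finsetSum _ fun a _ => hint3 a]
  have hi3 : Integrable (fun x => 3 * (tripleSq j k l x + δ)⁻¹ * ‖φ x‖ ^ 2) :=
    hφ.integrable_norm_sq (continuous_const.mul (hc0.inv₀ fun x => (hpos x).ne'))
  refine integral_mono hi3 (integrable_finsetSum _ fun a _ => hint3 a) fun x => ?_
  have hs := sum_tripleGrad_sq j k l x
  simp only [Fin.sum_univ_two, hg] at hs ⊢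
  set s := tripleSq j k l x + δ with hsdef
  have hs0 : 0 < s := hpos x
  -- Six coordinates contribute 2/s each, hence 12; by `sum_tripleGrad_sq` the negative terms add up
  -- to 3 · 3ρ²/s² ≤ 9/s. The surplus 3 is what makes the inequality nontrivial.
  have : 3 * s⁻¹ ≤ 12 / s - 9 * tripleSq j k l x / s ^ 2 := by
    have : 9 * tripleSq j k l x / s ^ 2 ≤ 9 / s := by
      rw [div_le_div_iff₀ (by positivity) hs0]
      have : tripleSq j k l x ≤ s := by linarith
      nlinarith [mul_le_mul_of_nonneg_right this hs0.le]
    have e : 12 / s - 9 / s = 3 * s⁻¹ := by ring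
    linarith
  refine (mul_le_mul_of_nonneg_right this (by positivity)).trans (le_of_eq ?_)
  linear_combination (3 / s ^ 2 * ‖φ x‖ ^ 2) * hs

/-- Hardy's inequality at the collisions of three particles. -/

theorem lintegral_tripleSq_inv_le {φ : Config N → ℂ} (hφ : IsTest φ) (α : ℝ) {j k l : Fin N}
    (hjk : j ≠ k) (hkl : k ≠ l) (hlj : l ≠ j) :
    ∫⁻ x, ENNReal.ofReal ((tripleSq j k l x)⁻¹ * ‖φ x‖ ^ 2) ≤ ENNReal.ofReal (kinetic α φ) := by
  -- On the compact support ρ² has a positive minimum. With δ below it, ρ² + δ ≤ 2ρ², so 3/(ρ² + δ)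
  -- ≥ 1/ρ² there; the final bound does not depend on δ.
  obtain ⟨δ, hδ, hle⟩ : ∃ δ, 0 < δ ∧ ∀ x ∈ tsupport φ, δ ≤ tripleSq j k l x := by
    refine hφ.compact.isCompact.exists_forall_le' (contDiff_tripleSq j k l).continuous.continuousOn
      fun x hx => ?_
    have hne : x j ≠ x k := fun h => hφ.support hx ⟨j, k, hjk, h⟩
    have : 0 < ‖x j - x k‖ := norm_pos_iff.2 (sub_ne_zero.2 hne)
    unfold tripleSq
    positivity
  have hpos : ∀ x, 0 < tripleSq j k l x + δ := fun x => by
    have := tripleSq_nonneg j k l x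
    positivity
  have hc0 : Continuous fun x => tripleSq j k l x + δ :=
    (contDiff_tripleSq j k l).continuous.add continuous_const
  have hi3 : Integrable (fun x => 3 * (tripleSq j k l x + δ)⁻¹ * ‖φ x‖ ^ 2) :=
    hφ.integrable_norm_sq (continuous_const.mul (hc0.inv₀ fun x => (hpos x).ne'))
  calc ∫⁻ x, ENNReal.ofReal ((tripleSq j k l x)⁻¹ * ‖φ x‖ ^ 2)
      ≤ ∫⁻ x, ENNReal.ofReal (3 * (tripleSq j k l x + δ)⁻¹ * ‖φ x‖ ^ 2) := by
        refine lintegral_mono fun x => ENNReal.ofReal_le_ofReal ?_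
        by_cases hx : x ∈ tsupport φ
        · refine mul_le_mul_of_nonneg_right ?_ (by positivity)
          have h1 := hle x hx
          have h2 : 0 < tripleSq j k l x := hδ.trans_le h1
          rw [← div_eq_mul_inv, inv_eq_one_div, div_le_div_iff₀ h2 (hpos x)]
          linarith
        · simp [image_eq_zero_of_notMem_tsupport hx]
    _ = ENNReal.ofReal (∫ x, 3 * (tripleSq j k l x + δ)⁻¹ * ‖φ x‖ ^ 2) :=
        (ofReal_integral_eq_lintegral_ofReal hi3 (Eventually.of_forall fun x => by
          have := hpos x
          simp only [Pi.zero_apply]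
          positivity)).symm
    _ ≤ _ := ENNReal.ofReal_le_ofReal (integral_tripleSq_add_inv_le hφ α hjk hkl hlj hδ)

/-! ### Averaging over measure-preserving maps and a twisted Poincaré inequality -/

/-- A linear map that preserves the Euclidean norm of `ℝ^{2N}` preserves Lebesgue measure. -/

theorem measurePreserving_of_sum_norm_sq (f : Config N →ₗ[ℝ] Config N)
    (hf : ∀ x, ∑ i, ‖f x i‖ ^ 2 = ∑ i, ‖x i‖ ^ 2) : MeasurePreserving f volume volume := by
  have hinj : Function.Injective f := by
    rw [← LinearMap.ker_eq_bot, LinearMap.ker_eq_bot']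
    intro x hx
    have h := hf x
    rw [hx] at h
    simp only [Pi.zero_apply, norm_zero, ne_eq, OfNat.ofNat_ne_zero, not_false_eq_true, zero_pow,
      Finset.sum_const_zero] at h
    funext i
    have := (Finset.sum_eq_zero_iff_of_nonneg fun i _ => by positivity).1 h.symm i (Finset.mem_univ i)
    simpa using this
  have hdet : LinearMap.det f ≠ 0 := by
    have h := (LinearEquiv.ofInjectiveEndo f hinj).isUnit_det'
    exact h.ne_zero
  have hcont : Continuous f := f.continuous_of_finiteDimensional
  refine ⟨hcont.measurable, ?_⟩
  -- `Config N` carries the sup norm over the particles, so the Euclidean unit ball is written out.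
  -- It is invariant under `f` and has finite positive volume, which forces |det f| = 1.
  set s : Set (Config N) := {x | ∑ i, ‖x i‖ ^ 2 ≤ 1} with hs
  have hpre : f ⁻¹' s = s := by
    ext x
    simp [hs, hf]
  have h1 := Measure.addHaar_preimage_linearMap (volume : Measure (Config N)) hdet s
  rw [hpre] at h1
  have hpos : volume s ≠ 0 := by
    refine (Measure.measure_pos_of_mem_nhds volume (x := (0 : Config N)) ?_).ne'
    have hc : Continuous fun x : Config N => ∑ i, ‖x i‖ ^ 2 := by fun_prop
    refine hc.continuousAt.preimage_mem_nhds (Iic_mem_nhds ?_)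
    simp
  have hfin : volume s ≠ ⊤ := by
    refine ((measure_mono ?_).trans_lt (measure_closedBall_lt_top (x := (0 : Config N))
      (r := 1))).ne
    intro x hx
    rw [mem_closedBall_zero_iff, pi_norm_le_iff_of_nonneg zero_le_one]
    intro i
    have : ‖x i‖ ^ 2 ≤ 1 := (Finset.single_le_sum (f := fun i => ‖x i‖ ^ 2)
      (fun i _ => by positivity) (Finset.mem_univ i)).trans hx
    exact (sq_le_one_iff₀ (norm_nonneg _)).1 this
  have h2 : ENNReal.ofReal |(LinearMap.det f)⁻¹| = 1 := by
    have : 1 * volume s = ENNReal.ofReal |(LinearMap.det f)⁻¹| * volume s := by rwa [one_mul]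
    exact ((ENNReal.mul_left_inj hpos hfin).1 this).symm
  rw [Measure.map_linearMap_addHaar_eq_smul_addHaar _ hdet, h2, one_smul]

/-- If `∫ F (T_θ x) dθ ≤ ∫ G (T_θ x) dθ` for all `x` and the `T_θ` preserve the measure, then
`∫ F ≤ ∫ G`. -/

theorem lintegral_le_of_average {X : Type*} [MeasurableSpace X] {μ : Measure X} [SFinite μ]
    {ν : Measure ℝ} [IsFiniteMeasure ν] (hν : ν ≠ 0) {T : ℝ → X → X}
    (hT : Measurable (Function.uncurry T)) (hμ : ∀ θ, MeasurePreserving (T θ) μ μ)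
    {F G : X → ENNReal} (hF : Measurable F) (hG : Measurable G)
    (h : ∀ x, ∫⁻ θ, F (T θ x) ∂ν ≤ ∫⁻ θ, G (T θ x) ∂ν) : ∫⁻ x, F x ∂μ ≤ ∫⁻ x, G x ∂μ := by
  -- By Tonelli, each angle contributes the same integral, so the double integral is ∫ K times the
  -- mass of ν; this finite nonzero mass cancels at the end.
  have key : ∀ K : X → ENNReal, Measurable K →
      ∫⁻ x, ∫⁻ θ, K (T θ x) ∂ν ∂μ = (∫⁻ x, K x ∂μ) * ν Set.univ := by
    intro K hK
    have hm : Measurable (Function.uncurry fun (x : X) (θ : ℝ) => K (T θ x)) :=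
      hK.comp (hT.comp measurable_swap)
    rw [lintegral_lintegral_swap hm.aemeasurable]
    simp_rw [fun θ => (hμ θ).lintegral_comp hK]
    rw [lintegral_const]
  have h1 := lintegral_mono (μ := μ) h
  rw [key F hF, key G hG] at h1
  exact (ENNReal.mul_le_mul_iff_left (by simpa using hν) (measure_ne_top ν _)).1 h1

/-- With M = ∫ |h'|, the function stays within M of h(0). The twist gives (κ - 1) h(0) = h(π) -
h(0), so h(0) itself is at most M / |κ - 1|. Hence |h| ≤ (1 + |κ - 1|⁻¹) M everywhere, and M² ≤ π ∫
|h'|². -/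
theorem integral_norm_sq_le_of_twisted_periodic {κ : ℂ} (hκ : κ ≠ 1) {h h' : ℝ → ℂ}
    (hd : ∀ θ, HasDerivAt h (h' θ) θ) (hc : Continuous h') (hper : h Real.pi = κ * h 0) :
    ∫ θ in (0)..Real.pi, ‖h θ‖ ^ 2 ≤
      ((1 + ‖κ - 1‖⁻¹) * Real.pi) ^ 2 * ∫ θ in (0)..Real.pi, ‖h' θ‖ ^ 2 := by
  have hπ := Real.pi_pos
  set M := ∫ θ in (0)..Real.pi, ‖h' θ‖ with hM
  have hh : Continuous h := continuous_iff_continuousAt.2 fun θ => (hd θ).continuousAt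
  have hdiff : ∀ θ ∈ Set.Icc 0 Real.pi, ‖h θ - h 0‖ ≤ M := by
    intro θ hθ
    rw [← intervalIntegral.integral_eq_sub_of_hasDerivAt (fun t _ => hd t)
      (hc.intervalIntegrable 0 θ)]
    refine (intervalIntegral.norm_integral_le_integral_norm hθ.1).trans ?_
    exact intervalIntegral.integral_mono_interval le_rfl hθ.1 hθ.2
      (Eventually.of_forall fun t => norm_nonneg _) (hc.norm.intervalIntegrable _ _)
  have hκ0 : 0 < ‖κ - 1‖ := norm_pos_iff.2 (sub_ne_zero.2 hκ)
  have h0 : ‖h 0‖ ≤ ‖κ - 1‖⁻¹ * M := by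
    have h1 := hdiff Real.pi ⟨hπ.le, le_rfl⟩
    rw [hper, show κ * h 0 - h 0 = (κ - 1) * h 0 by ring, norm_mul] at h1
    rw [inv_mul_eq_div, le_div_iff₀ hκ0]
    linarith
  have hsup : ∀ θ ∈ Set.Icc 0 Real.pi, ‖h θ‖ ^ 2 ≤ ((1 + ‖κ - 1‖⁻¹) * M) ^ 2 := by
    intro θ hθ
    refine pow_le_pow_left₀ (norm_nonneg _) ?_ 2
    have h1 := norm_le_norm_add_norm_sub' (h θ) (h 0)
    have h2 := hdiff θ hθ
    linarith
  -- Cauchy–Schwarz, obtained by expanding the square of |h'| minus its mean.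
  have hCS : M ^ 2 ≤ Real.pi * ∫ θ in (0)..Real.pi, ‖h' θ‖ ^ 2 := by
    have hnn : 0 ≤ ∫ θ in (0)..Real.pi, (‖h' θ‖ - M / Real.pi) ^ 2 :=
      intervalIntegral.integral_nonneg hπ.le fun θ _ => sq_nonneg _
    have e : ∫ θ in (0)..Real.pi, (‖h' θ‖ - M / Real.pi) ^ 2 =
        (∫ θ in (0)..Real.pi, ‖h' θ‖ ^ 2) - (2 * (M / Real.pi)) * M +
          Real.pi * (M / Real.pi) ^ 2 := by
      have e1 : ∀ θ, (‖h' θ‖ - M / Real.pi) ^ 2 =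
          ‖h' θ‖ ^ 2 - 2 * (M / Real.pi) * ‖h' θ‖ + (M / Real.pi) ^ 2 := fun θ => by ring
      simp only [e1]
      have i1 : IntervalIntegrable (fun θ => ‖h' θ‖ ^ 2) volume 0 Real.pi :=
        (hc.norm.pow 2).intervalIntegrable _ _
      have i2 := (hc.norm.const_mul (2 * (M / Real.pi))).intervalIntegrable (μ := volume) 0 Real.pi
      have i3 : IntervalIntegrable (fun _ : ℝ => (M / Real.pi) ^ 2) volume 0 Real.pi :=
        intervalIntegrable_const
      rw [intervalIntegral.integral_add (i1.sub i2) i3, intervalIntegral.integral_sub i1 i2,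
        intervalIntegral.integral_const_mul, intervalIntegral.integral_const]
      simp [hM]
    rw [e] at hnn
    have e2 : Real.pi * (M / Real.pi) ^ 2 = M ^ 2 / Real.pi := by field_simp
    have e3 : (2 * (M / Real.pi)) * M = 2 * (M ^ 2 / Real.pi) := by ring
    rw [e2, e3] at hnn
    have : M ^ 2 / Real.pi ≤ ∫ θ in (0)..Real.pi, ‖h' θ‖ ^ 2 := by linarith
    rw [div_le_iff₀ hπ] at this
    linarith
  calc ∫ θ in (0)..Real.pi, ‖h θ‖ ^ 2
      ≤ ∫ θ in (0)..Real.pi, ((1 + ‖κ - 1‖⁻¹) * M) ^ 2 :=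
        intervalIntegral.integral_mono_on hπ.le ((hh.norm.pow 2).intervalIntegrable _ _)
          intervalIntegrable_const hsup
    _ = (1 + ‖κ - 1‖⁻¹) ^ 2 * Real.pi * M ^ 2 := by
        rw [intervalIntegral.integral_const]
        simp
        ring
    _ ≤ (1 + ‖κ - 1‖⁻¹) ^ 2 * Real.pi * (Real.pi * ∫ θ in (0)..Real.pi, ‖h' θ‖ ^ 2) :=
        mul_le_mul_of_nonneg_left hCS (by positivity)
    _ = _ := by ring

/-! ### The half-turn of a pair and its gauge phase -/

/-- The argument of `(w + z₀ e^{iθ}) (w - z₀ e^{iθ}) / w²`. -/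

def arcPhase (z₀ w : ℂ) (θ : ℝ) : ℝ :=
  (Complex.log (1 + z₀ * Complex.exp (θ * Complex.I) / w)).im +
    (Complex.log (1 - z₀ * Complex.exp (θ * Complex.I) / w)).im

/-- The half-turn replaces z₀ by -z₀ and so exchanges the two logarithms: a particle outside the
disc produces no net phase. -/
theorem arcPhase_pi (z₀ w : ℂ) : arcPhase z₀ w Real.pi = arcPhase z₀ w 0 := by
  simp only [arcPhase, Complex.exp_pi_mul_I]
  simp only [Complex.ofReal_zero, zero_mul, Complex.exp_zero, mul_one, mul_neg, neg_div,
    sub_neg_eq_add, ← sub_eq_add_neg]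
  ring

theorem hasDerivAt_exp_mul_I (θ : ℝ) : HasDerivAt (fun t : ℝ => Complex.exp (t * Complex.I))
    (Complex.I * Complex.exp (θ * Complex.I)) θ := by
  have h := ((Complex.ofRealCLM.hasDerivAt (x := θ)).mul_const Complex.I).cexp
  simpa [mul_comm] using h

/-- Since |z₀| < |w|, both 1 ± z₀ e^{iθ}/w stay in the disc of radius 1 about 1, where the principal
logarithm is smooth. This is where the disc must contain no other particle. -/
theorem hasDerivAt_arcPhase {z₀ w : ℂ} (h : ‖z₀‖ < ‖w‖) (θ : ℝ) :
    HasDerivAt (arcPhase z₀ w)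
      ((z₀ * Complex.exp (θ * Complex.I) / (w + z₀ * Complex.exp (θ * Complex.I))).re -
        (z₀ * Complex.exp (θ * Complex.I) / (w - z₀ * Complex.exp (θ * Complex.I))).re) θ := by
  have hw : w ≠ 0 := norm_pos_iff.1 ((norm_nonneg _).trans_lt h)
  set e := z₀ * Complex.exp (θ * Complex.I) with he
  have hen : ‖e / w‖ < 1 := by
    rw [norm_div, he, norm_mul, Complex.norm_exp_ofReal_mul_I, mul_one]
    exact (div_lt_one (norm_pos_iff.2 hw)).2 h
  have hp : 1 + e / w ∈ Complex.slitPlane := Complex.mem_slitPlane_of_norm_lt_one hen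
  have hm : 1 - e / w ∈ Complex.slitPlane := by
    rw [sub_eq_add_neg]
    exact Complex.mem_slitPlane_of_norm_lt_one (by rwa [norm_neg])
  have hd : HasDerivAt (fun t : ℝ => z₀ * Complex.exp (t * Complex.I) / w)
      (Complex.I * e / w) θ := by
    have := ((hasDerivAt_exp_mul_I θ).const_mul z₀).div_const w
    rwa [show z₀ * (Complex.I * Complex.exp (θ * Complex.I)) = Complex.I * e by rw [he]; ring]
      at this
  have h1 := (hd.const_add 1).clog_real hp
  have h2 := (hd.const_sub 1).clog_real hm
  have h1' := Complex.imCLM.hasFDerivAt.comp_hasDerivAt θ h1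
  have h2' := Complex.imCLM.hasFDerivAt.comp_hasDerivAt θ h2
  have h3 := h1'.add h2'
  refine HasDerivAt.congr_deriv h3 ?_
  have e1 : Complex.I * e / w / (1 + e / w) = Complex.I * (e / (w + e)) := by
    rw [show (1 + e / w) = (w + e) / w by field_simp, div_div_div_cancel_right₀ hw, mul_div_assoc]
  have e2 : -(Complex.I * e / w) / (1 - e / w) = -(Complex.I * (e / (w - e))) := by
    rw [show (1 - e / w) = (w - e) / w by field_simp, neg_div, div_div_div_cancel_right₀ hw,
      mul_div_assoc]
  rw [← he, e1, e2]
  simp only [Complex.imCLM_apply, Complex.neg_im, Complex.I_mul_im]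
  ring

/-- The rotation of the plane by the angle `θ`. -/

def rot (θ : ℝ) (v : Plane) : Plane := Real.cos θ • v + Real.sin θ • perp v

theorem perp_add (u v : Plane) : perp (u + v) = perp u + perp v := by
  ext a
  fin_cases a <;> simp [perp]
  ring

theorem perp_smul (c : ℝ) (v : Plane) : perp (c • v) = c • perp v := by
  ext a
  fin_cases a <;> simp [perp]

theorem perp_perp (v : Plane) : perp (perp v) = -v := by
  ext a
  fin_cases a <;> simp [perp]

theorem perp_rot (θ : ℝ) (v : Plane) :
    perp (rot θ v) = -Real.sin θ • v + Real.cos θ • perp v := by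
  rw [rot, perp_add, perp_smul, perp_smul, perp_perp]
  module

theorem rot_add (θ : ℝ) (u v : Plane) : rot θ (u + v) = rot θ u + rot θ v := by
  simp only [rot, perp_add]
  module

theorem rot_smul (θ c : ℝ) (v : Plane) : rot θ (c • v) = c • rot θ v := by
  simp only [rot, perp_smul]
  module

theorem hasDerivAt_rot (v : Plane) (θ : ℝ) :
    HasDerivAt (fun t => rot t v) (perp (rot θ v)) θ := by
  rw [perp_rot]
  exact ((Real.hasDerivAt_cos θ).smul_const v).add ((Real.hasDerivAt_sin θ).smul_const (perp v))

theorem norm_rot (θ : ℝ) (v : Plane) : ‖rot θ v‖ = ‖v‖ := by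
  refine (sq_eq_sq₀ (norm_nonneg _) (norm_nonneg _)).1 ?_
  simp only [EuclideanSpace.norm_sq_eq, Fin.sum_univ_two, Real.norm_eq_abs, sq_abs, rot,
    PiLp.add_apply, PiLp.smul_apply, perp_zero_apply, perp_one_apply, smul_eq_mul]
  linear_combination (v 0 ^ 2 + v 1 ^ 2) * Real.sin_sq_add_cos_sq θ

theorem continuous_perp : Continuous perp := by
  have : Continuous fun v : Plane => WithLp.toLp 2 ![-v 1, v 0] := by
    refine (PiLp.continuous_toLp 2 _).comp (continuous_pi fun a => ?_)
    fin_cases a <;> simp <;> fun_prop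
  exact this

/-- The plane as the complex numbers. -/

def toComplex (v : Plane) : ℂ := ⟨v 0, v 1⟩

theorem toComplex_add (u v : Plane) : toComplex (u + v) = toComplex u + toComplex v := by
  apply Complex.ext <;> simp [toComplex]

theorem toComplex_sub (u v : Plane) : toComplex (u - v) = toComplex u - toComplex v := by
  apply Complex.ext <;> simp [toComplex]

theorem toComplex_smul (c : ℝ) (v : Plane) : toComplex (c • v) = c * toComplex v := by
  apply Complex.ext <;> simp [toComplex]

theorem normSq_toComplex (v : Plane) : Complex.normSq (toComplex v) = ‖v‖ ^ 2 := by
  rw [EuclideanSpace.norm_sq_eq]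
  simp [toComplex, Complex.normSq_apply, sq]

theorem norm_toComplex (v : Plane) : ‖toComplex v‖ = ‖v‖ := by
  rw [← sq_eq_sq₀ (norm_nonneg _) (norm_nonneg _), Complex.sq_norm, normSq_toComplex]

theorem toComplex_rot (θ : ℝ) (v : Plane) :
    toComplex (rot θ v) = toComplex v * Complex.exp (θ * Complex.I) := by
  rw [Complex.exp_mul_I]
  apply Complex.ext
  · simp [toComplex, rot, perp_zero_apply, Complex.cos_ofReal_re, Complex.sin_ofReal_re]
    ring
  · simp [toComplex, rot, perp_one_apply, Complex.cos_ofReal_re, Complex.sin_ofReal_re]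
    ring

/-- The tangential component of the potential of one particle becomes the real part of a complex
quotient, the form in which derivatives of `arcPhase` appear. -/
theorem sum_perp_mul_kernel (u v : Plane) :
    ∑ a, perp u a * ((‖v‖ ^ 2)⁻¹ * perp v a) = (toComplex u / toComplex v).re := by
  rw [Complex.div_re, normSq_toComplex]
  simp only [Fin.sum_univ_two, perp_zero_apply, perp_one_apply, toComplex]
  ring

/-- The direction in which the particles `j` and `k` move oppositely along `u`. -/

def pairShift (j k : Fin N) : Plane →ₗ[ℝ] Config N :=
  LinearMap.single ℝ (fun _ => Plane) j - LinearMap.single ℝ (fun _ => Plane) k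

theorem pairShift_left {j k : Fin N} (h : j ≠ k) (u : Plane) : pairShift j k u j = u := by
  simp [pairShift, h]

theorem pairShift_right {j k : Fin N} (h : j ≠ k) (u : Plane) : pairShift j k u k = -u := by
  simp [pairShift, h.symm]

theorem pairShift_other {j k l : Fin N} (hj : l ≠ j) (hk : l ≠ k) (u : Plane) :
    pairShift j k u l = 0 := by
  simp [pairShift, hj, hk]

theorem pairShift_eq_sum (j k : Fin N) (u : Plane) :
    pairShift j k u = ∑ a, u a • (unitVec j a - unitVec k a) := by
  funext i
  ext b
  simp only [Fin.sum_univ_two, pairShift, LinearMap.sub_apply, LinearMap.coe_single, Pi.sub_apply,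
    Pi.add_apply, Pi.smul_apply, PiLp.sub_apply, PiLp.add_apply, PiLp.smul_apply, unitVec_apply,
    Pi.single_apply, smul_eq_mul]
  fin_cases b <;> simp <;> split_ifs <;> simp

theorem fderiv_pairShift (φ : Config N → ℂ) (y : Config N) (j k : Fin N) (u : Plane) :
    fderiv ℝ φ y (pairShift j k u) =
      ∑ a, (u a : ℂ) * (partialDeriv j a φ y - partialDeriv k a φ y) := by
  rw [pairShift_eq_sum, map_sum]
  refine Finset.sum_congr rfl fun a _ => ?_
  rw [map_smul, map_sub, Complex.real_smul]
  rfl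

/-- The rotation of the particles `j` and `k` about their centre by the angle `θ`. -/

def pairRot (j k : Fin N) (θ : ℝ) : Config N →ₗ[ℝ] Config N where
  toFun x := x + pairShift j k ((1 / 2 : ℝ) • (rot θ (x j - x k) - (x j - x k)))
  map_add' x y := by
    have : (x + y) j - (x + y) k = (x j - x k) + (y j - y k) := by
      simp only [Pi.add_apply]
      abel
    rw [this, rot_add]
    simp only [map_smul, map_sub, map_add]
    module
  map_smul' c x := by
    have : (c • x) j - (c • x) k = c • (x j - x k) := by
      simp only [Pi.smul_apply, smul_sub]
    rw [this, rot_smul]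
    simp only [map_smul, map_sub, RingHom.id_apply]
    module

theorem pairRot_apply (j k : Fin N) (θ : ℝ) (x : Config N) : pairRot j k θ x =
    x + pairShift j k ((1 / 2 : ℝ) • (rot θ (x j - x k) - (x j - x k))) := rfl

theorem pairRot_left {j k : Fin N} (h : j ≠ k) (θ : ℝ) (x : Config N) : pairRot j k θ x j =
    (1 / 2 : ℝ) • (x j + x k) + (1 / 2 : ℝ) • rot θ (x j - x k) := by
  rw [pairRot_apply, Pi.add_apply, pairShift_left h]
  module

theorem pairRot_right {j k : Fin N} (h : j ≠ k) (θ : ℝ) (x : Config N) : pairRot j k θ x k =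
    (1 / 2 : ℝ) • (x j + x k) - (1 / 2 : ℝ) • rot θ (x j - x k) := by
  rw [pairRot_apply, Pi.add_apply, pairShift_right h]
  module

theorem pairRot_other {j k l : Fin N} (hj : l ≠ j) (hk : l ≠ k) (θ : ℝ) (x : Config N) :
    pairRot j k θ x l = x l := by
  rw [pairRot_apply, Pi.add_apply, pairShift_other hj hk, add_zero]

theorem pairRot_sub {j k : Fin N} (h : j ≠ k) (θ : ℝ) (x : Config N) :
    pairRot j k θ x j - pairRot j k θ x k = rot θ (x j - x k) := by
  rw [pairRot_left h, pairRot_right h]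
  module

theorem pairRot_add {j k : Fin N} (h : j ≠ k) (θ : ℝ) (x : Config N) :
    pairRot j k θ x j + pairRot j k θ x k = x j + x k := by
  rw [pairRot_left h, pairRot_right h]
  module

theorem pairRot_zero (j k : Fin N) (x : Config N) : pairRot j k 0 x = x := by
  simp [pairRot_apply, rot]

theorem pairRot_pi {j k : Fin N} (h : j ≠ k) (x : Config N) :
    pairRot j k Real.pi x = x ∘ Equiv.swap j k := by
  funext i
  by_cases hj : i = j
  · subst hj
    rw [pairRot_left h]
    simp only [rot, Real.cos_pi, Real.sin_pi, Function.comp_apply, Equiv.swap_apply_left]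
    module
  · by_cases hk : i = k
    · subst hk
      rw [pairRot_right h]
      simp only [rot, Real.cos_pi, Real.sin_pi, Function.comp_apply, Equiv.swap_apply_right]
      module
    · rw [pairRot_other hj hk, Function.comp_apply, Equiv.swap_apply_of_ne_of_ne hj hk]

/-- The centre of the pair is fixed and the difference is rotated, so the parallelogram law
preserves |x_j|² + |x_k|². -/
theorem measurePreserving_pairRot {j k : Fin N} (h : j ≠ k) (θ : ℝ) :
    MeasurePreserving (pairRot j k θ : Config N → Config N) volume volume := by
  refine measurePreserving_of_sum_norm_sq _ fun x => ?_
  rw [← sub_eq_zero, ← Finset.sum_sub_distrib, Fintype.sum_eq_add j k h fun l hl => by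
    rw [pairRot_other hl.1 hl.2, sub_self]]
  have h1 := parallelogram_law_with_norm ℝ ((1 / 2 : ℝ) • (x j + x k))
    ((1 / 2 : ℝ) • rot θ (x j - x k))
  have h2 := parallelogram_law_with_norm ℝ ((1 / 2 : ℝ) • (x j + x k)) ((1 / 2 : ℝ) • (x j - x k))
  rw [← pairRot_left h, ← pairRot_right h, norm_smul _ (rot _ _), norm_rot, ← norm_smul] at h1
  rw [show (1 / 2 : ℝ) • (x j + x k) + (1 / 2 : ℝ) • (x j - x k) = x j by module,
    show (1 / 2 : ℝ) • (x j + x k) - (1 / 2 : ℝ) • (x j - x k) = x k by module] at h2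
  linarith

theorem hasDerivAt_pairRot (j k : Fin N) (x : Config N) (θ : ℝ) :
    HasDerivAt (fun t => pairRot j k t x)
      (pairShift j k ((1 / 2 : ℝ) • perp (rot θ (x j - x k)))) θ := by
  have h := ((hasDerivAt_rot (x j - x k) θ).sub_const (x j - x k)).const_smul (1 / 2 : ℝ)
  have h2 := ((pairShift j k).toContinuousLinearMap.hasFDerivAt.comp_hasDerivAt θ h).const_add x
  exact h2

theorem continuous_pairRot (j k : Fin N) :
    Continuous (fun p : ℝ × Config N => pairRot j k p.1 p.2) := by
  have hr : Continuous fun p : ℝ × Config N => rot p.1 (p.2 j - p.2 k) := by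
    have h1 : Continuous fun p : ℝ × Config N => p.2 j - p.2 k := by fun_prop
    exact ((Real.continuous_cos.comp continuous_fst).smul h1).add
      ((Real.continuous_sin.comp continuous_fst).smul (continuous_perp.comp h1))
  have h2 : Continuous fun p : ℝ × Config N => rot p.1 (p.2 j - p.2 k) - (p.2 j - p.2 k) :=
    hr.sub (by fun_prop)
  exact continuous_snd.add
    ((pairShift j k).continuous_of_finiteDimensional.comp (h2.const_smul (1 / 2 : ℝ)))

/-- The configurations for which no other particle lies in the disc with diameter `x_j x_k`. -/

def pairAlone (j k : Fin N) : Set (Config N) :=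
  {x | ∀ l, l ≠ j → l ≠ k → ‖(1 / 2 : ℝ) • (x j - x k)‖ < ‖(1 / 2 : ℝ) • (x j + x k) - x l‖}

theorem measurableSet_pairAlone (j k : Fin N) : MeasurableSet (pairAlone j k) := by
  have : pairAlone j k = ⋂ l, ⋂ (_ : l ≠ j), ⋂ (_ : l ≠ k),
      {x : Config N | ‖(1 / 2 : ℝ) • (x j - x k)‖ < ‖(1 / 2 : ℝ) • (x j + x k) - x l‖} := by
    ext x
    simp [pairAlone]
  rw [this]
  refine MeasurableSet.iInter fun l => MeasurableSet.iInter fun _ => MeasurableSet.iInter fun _ => ?_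
  exact (isOpen_lt (by fun_prop) (by fun_prop)).measurableSet

theorem pairRot_mem_pairAlone {j k : Fin N} (h : j ≠ k) (θ : ℝ) (x : Config N) :
    pairRot j k θ x ∈ pairAlone j k ↔ x ∈ pairAlone j k := by
  refine forall_congr' fun l => forall_congr' fun hj => forall_congr' fun hk => ?_
  rw [pairRot_sub h, pairRot_add h, pairRot_other hj hk, norm_smul, norm_rot, ← norm_smul]

/-- The mutual terms of j and k give 1/2 each, hence the 1, which is the angular speed of the pair's
own phase. The remaining terms pair up into the derivatives of `arcPhase`. -/
theorem sum_perp_mul_vectorPotential {j k : Fin N} (hjk : j ≠ k) {y : Config N}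
    (hy : y j ≠ y k) :
    ∑ a, perp ((1 / 2 : ℝ) • (y j - y k)) a * (vectorPotential j y a - vectorPotential k y a) =
      1 + ∑ l ∈ (Finset.univ.erase j).erase k,
        ((toComplex ((1 / 2 : ℝ) • (y j - y k)) / toComplex (y j - y l)).re -
          (toComplex ((1 / 2 : ℝ) • (y j - y k)) / toComplex (y k - y l)).re) := by
  set u := (1 / 2 : ℝ) • (y j - y k) with hu
  have h1 : ∀ i : Fin N, ∑ a, perp u a * vectorPotential i y a =
      ∑ l ∈ Finset.univ.erase i, (toComplex u / toComplex (y i - y l)).re := by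
    intro i
    simp only [vectorPotential_apply, Finset.mul_sum]
    rw [Finset.sum_comm]
    simp only [sum_perp_mul_kernel]
  simp only [mul_sub, Finset.sum_sub_distrib, h1]
  rw [← Finset.add_sum_erase (Finset.univ.erase j) _ (a := k) (by simp [hjk.symm]),
    ← Finset.add_sum_erase (Finset.univ.erase k) _ (a := j) (by simp [hjk]),
    Finset.erase_right_comm (a := k) (b := j)]
  have hr : toComplex (y j - y k) ≠ 0 := by
    rw [← norm_ne_zero_iff, norm_toComplex, norm_ne_zero_iff]
    exact sub_ne_zero.2 hy
  have e1 : toComplex u / toComplex (y j - y k) = ((1 / 2 : ℝ) : ℂ) := by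
    rw [hu, toComplex_smul, mul_div_cancel_right₀ _ hr]
  have e2 : toComplex u / toComplex (y k - y j) = ((-(1 / 2) : ℝ) : ℂ) := by
    rw [show y k - y j = (-1 : ℝ) • (y j - y k) by module, toComplex_smul (-1), hu, toComplex_smul,
      mul_div_mul_right _ _ hr]
    push_cast
    ring
  rw [e1, e2, Complex.ofReal_re, Complex.ofReal_re]
  ring

/-- The gauge phase along the rotation of a pair that encloses no other particle. -/

def pairPhase (j k : Fin N) (x : Config N) (θ : ℝ) : ℝ :=
  θ + ∑ l ∈ (Finset.univ.erase j).erase k, arcPhase (toComplex ((1 / 2 : ℝ) • (x j - x k)))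
    (toComplex ((1 / 2 : ℝ) • (x j + x k) - x l)) θ

/-- Only the pair's own angle accumulates over the half-turn; every other contribution returns to
its initial value. -/
theorem pairPhase_pi (j k : Fin N) (x : Config N) :
    pairPhase j k x Real.pi = Real.pi + pairPhase j k x 0 := by
  simp [pairPhase, arcPhase_pi]

theorem hasDerivAt_pairPhase {j k : Fin N} (hjk : j ≠ k) {x : Config N} (hx : x ∈ pairAlone j k)
    (hne : x j ≠ x k) (θ : ℝ) :
    HasDerivAt (pairPhase j k x) (∑ a, ((1 / 2 : ℝ) • perp (rot θ (x j - x k))) a *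
      (vectorPotential j (pairRot j k θ x) a - vectorPotential k (pairRot j k θ x) a)) θ := by
  set y := pairRot j k θ x with hy
  have hyr : y j - y k = rot θ (x j - x k) := pairRot_sub hjk θ x
  have hyne : y j ≠ y k := by
    rw [← sub_ne_zero, ← norm_ne_zero_iff, hyr, norm_rot, norm_ne_zero_iff]
    exact sub_ne_zero.2 hne
  have h1 := sum_perp_mul_vectorPotential hjk hyne
  rw [perp_smul, hyr] at h1
  rw [h1]
  refine (hasDerivAt_id θ).add (HasDerivAt.fun_sum fun l hl => ?_)
  have hlk : l ≠ k := Finset.ne_of_mem_erase hl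
  have hlj : l ≠ j := Finset.ne_of_mem_erase (Finset.mem_of_mem_erase hl)
  have h2 := hasDerivAt_arcPhase (z₀ := toComplex ((1 / 2 : ℝ) • (x j - x k)))
    (w := toComplex ((1 / 2 : ℝ) • (x j + x k) - x l)) (by
      rw [norm_toComplex, norm_toComplex]
      exact hx l hlj hlk) θ
  rw [← toComplex_rot, rot_smul, ← toComplex_add, ← toComplex_sub] at h2
  have e1 : (1 / 2 : ℝ) • (x j + x k) - x l + (1 / 2 : ℝ) • rot θ (x j - x k) = y j - y l := by
    rw [hy, pairRot_left hjk, pairRot_other hlj hlk]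
    abel
  have e2 : (1 / 2 : ℝ) • (x j + x k) - x l - (1 / 2 : ℝ) • rot θ (x j - x k) = y k - y l := by
    rw [hy, pairRot_right hjk, pairRot_other hlj hlk]
    abel
  rwa [e1, e2] at h2

/-- `(D_j - D_k) φ` along the rotation of the pair `j`, `k`. -/

def pairAngular (α : ℝ) (j k : Fin N) (φ : Config N → ℂ) (x : Config N) (θ : ℝ) : ℂ :=
  ∑ a, Complex.I * (((1 / 2 : ℝ) • perp (rot θ (x j - x k))) a : ℂ) *
    (magneticDeriv α j a φ (pairRot j k θ x) - magneticDeriv α k a φ (pairRot j k θ x))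

/-- Along the rotation, ∂ = iD - iαA, and differentiating the exponential supplies exactly the term
that cancels -iαA. Only magnetic derivatives remain. -/
theorem hasDerivAt_pairPhase_mul {φ : Config N → ℂ} (hφ : IsTest φ) (α : ℝ) {j k : Fin N}
    (hjk : j ≠ k) {x : Config N} (hx : x ∈ pairAlone j k) (hne : x j ≠ x k) (θ : ℝ) :
    HasDerivAt (fun t => Complex.exp ((α * pairPhase j k x t : ℝ) * Complex.I) *
        φ (pairRot j k t x))
      (Complex.exp ((α * pairPhase j k x θ : ℝ) * Complex.I) * pairAngular α j k φ x θ) θ := by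
  have h1 := ((hasDerivAt_pairPhase hjk hx hne θ).const_mul α).ofReal_comp.mul_const
    Complex.I |>.cexp
  have h2 := (hφ.differentiable (pairRot j k θ x)).hasFDerivAt.comp_hasDerivAt θ
    (hasDerivAt_pairRot j k x θ)
  rw [fderiv_pairShift] at h2
  refine (h1.mul h2).congr_deriv ?_
  simp only [pairAngular, magneticDeriv, Function.comp_apply, Fin.sum_univ_two]
  push_cast
  ring_nf
  simp only [Complex.I_sq]
  ring

/-- The velocity of each particle has length |x_j - x_k| / 2. Cauchy–Schwarz over the two
coordinates and over the difference D_j - D_k gives the bound, with room to spare in the constant.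
-/
theorem norm_pairAngular_sq_le (α : ℝ) (j k : Fin N) (φ : Config N → ℂ) (x : Config N) (θ : ℝ) :
    ‖pairAngular α j k φ x θ‖ ^ 2 ≤ ‖x j - x k‖ ^ 2 *
      ∑ a, (‖magneticDeriv α j a φ (pairRot j k θ x)‖ ^ 2 +
        ‖magneticDeriv α k a φ (pairRot j k θ x)‖ ^ 2) := by
  set y := pairRot j k θ x
  set u := (1 / 2 : ℝ) • perp (rot θ (x j - x k)) with hu
  have hn : ‖x j - x k‖ ^ 2 = 4 * (u 0 ^ 2 + u 1 ^ 2) := by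
    rw [← norm_rot θ (x j - x k), hu]
    simp only [EuclideanSpace.norm_sq_eq, Fin.sum_univ_two, Real.norm_eq_abs, sq_abs,
      PiLp.smul_apply, perp_zero_apply, perp_one_apply, smul_eq_mul]
    ring
  set d : Fin 2 → ℂ := fun a => magneticDeriv α j a φ y - magneticDeriv α k a φ y with hd
  have hle : ‖pairAngular α j k φ x θ‖ ≤ |u 0| * ‖d 0‖ + |u 1| * ‖d 1‖ := by
    rw [pairAngular, Fin.sum_univ_two]
    refine (norm_add_le _ _).trans (le_of_eq ?_)
    simp [hd, hu, y]
  have hda : ∀ a, ‖d a‖ ^ 2 ≤ 2 * (‖magneticDeriv α j a φ y‖ ^ 2 + ‖magneticDeriv α k a φ y‖ ^ 2) := by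
    intro a
    have := norm_sub_le (magneticDeriv α j a φ y) (magneticDeriv α k a φ y)
    have h0 := norm_nonneg (d a)
    nlinarith [sq_nonneg (‖magneticDeriv α j a φ y‖ - ‖magneticDeriv α k a φ y‖)]
  have h0 := hda 0
  have h1 := hda 1
  rw [Fin.sum_univ_two, hn]
  calc ‖pairAngular α j k φ x θ‖ ^ 2 ≤ (|u 0| * ‖d 0‖ + |u 1| * ‖d 1‖) ^ 2 :=
        pow_le_pow_left₀ (norm_nonneg _) hle 2
    _ ≤ (u 0 ^ 2 + u 1 ^ 2) * (‖d 0‖ ^ 2 + ‖d 1‖ ^ 2) := by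
        rw [← sq_abs (u 0), ← sq_abs (u 1)]
        nlinarith [sq_nonneg (|u 0| * ‖d 1‖ - |u 1| * ‖d 0‖)]
    _ ≤ (u 0 ^ 2 + u 1 ^ 2) * (4 * (‖magneticDeriv α j 0 φ y‖ ^ 2 + ‖magneticDeriv α k 0 φ y‖ ^ 2 +
          (‖magneticDeriv α j 1 φ y‖ ^ 2 + ‖magneticDeriv α k 1 φ y‖ ^ 2))) := by
        refine mul_le_mul_of_nonneg_left ?_ (by positivity)
        nlinarith [sq_nonneg ‖magneticDeriv α j 0 φ y‖, sq_nonneg ‖magneticDeriv α k 0 φ y‖,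
          sq_nonneg ‖magneticDeriv α j 1 φ y‖, sq_nonneg ‖magneticDeriv α k 1 φ y‖]
    _ = _ := by ring

theorem continuous_pairRot_angle (j k : Fin N) (x : Config N) :
    Continuous fun θ => pairRot j k θ x :=
  continuous_iff_continuousAt.2 fun θ => (hasDerivAt_pairRot j k x θ).continuousAt

theorem continuous_pairAngular {φ : Config N → ℂ} (hφ : IsTest φ) (α : ℝ) (j k : Fin N)
    (x : Config N) : Continuous (pairAngular α j k φ x) := by
  have hT := continuous_pairRot_angle j k x
  have hrot : Continuous fun θ => rot θ (x j - x k) :=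
    continuous_iff_continuousAt.2 fun θ => (hasDerivAt_rot _ θ).continuousAt
  refine continuous_finsetSum _ fun a _ => ?_
  have h1 : Continuous fun θ => ((1 / 2 : ℝ) • perp (rot θ (x j - x k))) a :=
    (EuclideanSpace.proj a : Plane →L[ℝ] ℝ).continuous.comp
      ((continuous_perp.comp hrot).const_smul (1 / 2 : ℝ))
  exact (continuous_const.mul (Complex.continuous_ofReal.comp h1)).mul
    (((hφ.magneticDeriv α j a).continuous.comp hT).sub
      ((hφ.magneticDeriv α k a).continuous.comp hT))

/-! ### Hardy's inequality for pairs -/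

/-- The constant in Hardy's inequality for two particles. -/

def pairConst (α : ℝ) : ℝ :=
  ((1 + ‖Complex.exp ((α * Real.pi : ℝ) * Complex.I) - 1‖⁻¹) * Real.pi) ^ 2

theorem integral_pairRot_le {φ : Config N → ℂ} (hφ : IsCore φ) {α : ℝ}
    (hα : Complex.exp ((α * Real.pi : ℝ) * Complex.I) ≠ 1) {j k : Fin N}
    (hjk : j ≠ k) {x : Config N} (hx : x ∈ pairAlone j k) (hne : x j ≠ x k) :
    ∫ θ in (0)..Real.pi, ‖φ (pairRot j k θ x)‖ ^ 2 ≤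
      pairConst α * ∫ θ in (0)..Real.pi, ‖pairAngular α j k φ x θ‖ ^ 2 := by
  have hph : Continuous (pairPhase j k x) :=
    continuous_iff_continuousAt.2 fun θ => (hasDerivAt_pairPhase hjk hx hne θ).continuousAt
  have hang := continuous_pairAngular hφ.isTest α j k x
  have hexp : Continuous fun θ => Complex.exp ((α * pairPhase j k x θ : ℝ) * Complex.I) :=
    Complex.continuous_exp.comp ((Complex.continuous_ofReal.comp
      (continuous_const.mul hph)).mul continuous_const)
  have hper : Complex.exp ((α * pairPhase j k x Real.pi : ℝ) * Complex.I) *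
      φ (pairRot j k Real.pi x) = Complex.exp ((α * Real.pi : ℝ) * Complex.I) *
        (Complex.exp ((α * pairPhase j k x 0 : ℝ) * Complex.I) * φ (pairRot j k 0 x)) := by
    -- The bosonic symmetry enters here: the half-turn is a transposition, which leaves φ unchanged,
    -- so the only change is the phase factor e^{iαπ}.
    rw [pairRot_pi hjk, hφ.symm, pairRot_zero, pairPhase_pi, ← mul_assoc, ← Complex.exp_add]
    congr 2
    push_cast
    ring
  have key := integral_norm_sq_le_of_twisted_periodic hα
    (fun θ => hasDerivAt_pairPhase_mul hφ.isTest α hjk hx hne θ) (hexp.mul hang) hper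
  simpa only [pairConst, norm_mul, Complex.norm_exp_ofReal_mul_I, one_mul] using key

theorem pairConst_nonneg (α : ℝ) : 0 ≤ pairConst α := sq_nonneg _

theorem lintegral_Icc_ofReal {f : ℝ → ℝ} (hf : Continuous f) (h0 : ∀ θ, 0 ≤ f θ) :
    ∫⁻ θ in Set.Icc 0 Real.pi, ENNReal.ofReal (f θ) =
      ENNReal.ofReal (∫ θ in (0)..Real.pi, f θ) := by
  rw [intervalIntegral.integral_of_le Real.pi_pos.le, ← integral_Icc_eq_integral_Ioc,
    ofReal_integral_eq_lintegral_ofReal (hf.continuousOn.integrableOn_compact isCompact_Icc)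
      (Eventually.of_forall h0)]

/-- Hardy's inequality for two particles, where no other particle is between them. -/

theorem lintegral_pairAlone_le {φ : Config N → ℂ} (hφ : IsCore φ) {α : ℝ}
    (hα : Complex.exp ((α * Real.pi : ℝ) * Complex.I) ≠ 1) {j k : Fin N} (hjk : j ≠ k) :
    ∫⁻ x, (pairAlone j k).indicator
        (fun x => ENNReal.ofReal ((‖x j - x k‖ ^ 2)⁻¹ * ‖φ x‖ ^ 2)) x ≤
      ∫⁻ x, ENNReal.ofReal (pairConst α * ∑ a, (‖magneticDeriv α j a φ x‖ ^ 2 +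
        ‖magneticDeriv α k a φ x‖ ^ 2)) := by
  have hDc : Continuous fun x => ∑ a, (‖magneticDeriv α j a φ x‖ ^ 2 +
        ‖magneticDeriv α k a φ x‖ ^ 2) :=
    continuous_finsetSum _ fun a _ => ((hφ.isTest.magneticDeriv α j a).continuous.norm.pow 2).add
      ((hφ.isTest.magneticDeriv α k a).continuous.norm.pow 2)
  have hφc := hφ.smooth.continuous
  -- Both the distance of the pair and membership in `pairAlone` are constant along the rotation, so
  -- the weight leaves the integral over the angle.
  refine lintegral_le_of_average (ν := volume.restrict (Set.Icc 0 Real.pi)) ?_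
    (T := fun θ x => pairRot j k θ x) (continuous_pairRot j k).measurable
    (measurePreserving_pairRot hjk) ?_
    (continuous_const.mul hDc).measurable.ennreal_ofReal fun x => ?_
  · intro h
    have := congrArg (fun μ => μ Set.univ) h
    simp [Real.pi_pos.not_ge] at this
  · refine Measurable.indicator ?_ (measurableSet_pairAlone j k)
    have h1 : Measurable fun x : Config N => ‖x j - x k‖ ^ 2 :=
      (contDiff_norm_sub_sq j k).continuous.measurable
    exact (h1.inv.mul (hφc.norm.pow 2).measurable).ennreal_ofReal
  · have hT := continuous_pairRot_angle j k x
    by_cases hx : x ∈ pairAlone j k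
    swap
    · simp [Set.indicator, pairRot_mem_pairAlone hjk, hx]
    -- At a collision the weight is 0 because 0⁻¹ = 0.
    by_cases hne : x j = x k
    · simp [Set.indicator, pairRot_sub hjk, norm_rot, hne]
    simp only [Set.indicator, pairRot_mem_pairAlone hjk, hx, if_true, pairRot_sub hjk, norm_rot]
    have hr : 0 < ‖x j - x k‖ ^ 2 := by
      have := norm_pos_iff.2 (sub_ne_zero.2 hne)
      positivity
    have c1 : Continuous fun θ => (‖x j - x k‖ ^ 2)⁻¹ * ‖φ (pairRot j k θ x)‖ ^ 2 :=
      continuous_const.mul ((hφc.comp hT).norm.pow 2)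
    have c2 : Continuous fun θ => pairConst α * ∑ a, (‖magneticDeriv α j a φ (pairRot j k θ x)‖ ^ 2 +
        ‖magneticDeriv α k a φ (pairRot j k θ x)‖ ^ 2) := continuous_const.mul (hDc.comp hT)
    rw [lintegral_Icc_ofReal c1 fun θ => by positivity, lintegral_Icc_ofReal c2
      fun θ => mul_nonneg (pairConst_nonneg α) (by positivity)]
    refine ENNReal.ofReal_le_ofReal ?_
    rw [intervalIntegral.integral_const_mul, intervalIntegral.integral_const_mul,
      inv_mul_le_iff₀ hr]
    refine (integral_pairRot_le hφ hα hjk hx hne).trans ?_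
    rw [mul_left_comm]
    refine mul_le_mul_of_nonneg_left ?_ (pairConst_nonneg α)
    rw [← intervalIntegral.integral_const_mul]
    refine intervalIntegral.integral_mono_on_of_le_Ioo Real.pi_pos.le ?_ ?_
      fun θ _ => norm_pairAngular_sq_le α j k φ x θ
    · exact ((continuous_pairAngular hφ.isTest α j k x).norm.pow 2).intervalIntegrable _ _
    · exact (continuous_const.mul (hDc.comp hT)).intervalIntegrable _ _

theorem kinetic_nonneg (α : ℝ) (φ : Config N → ℂ) : 0 ≤ kinetic α φ :=
  Finset.sum_nonneg fun _ _ => Finset.sum_nonneg fun _ _ => integral_nonneg fun _ => by positivity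

theorem IsTest.integrable_sq {φ : Config N → ℂ} (h : IsTest φ) :
    Integrable (fun x => ‖φ x‖ ^ 2) := by
  simpa using h.integrable_norm_sq (continuous_const (y := (1 : ℝ)))

theorem integral_le_kinetic (α : ℝ) (φ : Config N → ℂ) (j : Fin N) (a : Fin 2) :
    ∫ x, ‖magneticDeriv α j a φ x‖ ^ 2 ≤ kinetic α φ := by
  have h0 : ∀ i b, 0 ≤ ∫ x, ‖magneticDeriv α i b φ x‖ ^ 2 :=
    fun i b => integral_nonneg fun _ => by positivity
  exact (Finset.single_le_sum (f := fun b => ∫ x, ‖magneticDeriv α j b φ x‖ ^ 2)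
    (fun b _ => h0 j b) (Finset.mem_univ a)).trans
    (Finset.single_le_sum (f := fun i => ∑ b, ∫ x, ‖magneticDeriv α i b φ x‖ ^ 2)
      (fun i _ => Finset.sum_nonneg fun b _ => h0 i b) (Finset.mem_univ j))

/-- A point of the disc is within a diameter of both ends of the diameter, so all three squared
distances are at most |x_j - x_k|². If x_j = x_k, the left side is 0 by the convention for inverses.
-/
theorem inv_norm_sub_sq_le {j k l : Fin N} {x : Config N}
    (h : ‖(1 / 2 : ℝ) • (x j + x k) - x l‖ ≤ ‖(1 / 2 : ℝ) • (x j - x k)‖) :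
    (‖x j - x k‖ ^ 2)⁻¹ ≤ 3 * (tripleSq j k l x)⁻¹ := by
  by_cases hne : x j = x k
  · have := tripleSq_nonneg j k l x
    simp only [hne, sub_self, norm_zero, ne_eq, OfNat.ofNat_ne_zero, not_false_eq_true, zero_pow,
      inv_zero]
    positivity
  have hr := norm_pos_iff.2 (sub_ne_zero.2 hne)
  have hhalf : ‖(1 / 2 : ℝ) • (x j - x k)‖ = ‖x j - x k‖ / 2 := by
    rw [norm_smul]
    norm_num
    ring
  have h1 : ‖x l - x j‖ ≤ ‖x j - x k‖ := by
    rw [norm_sub_rev, show x j - x l = ((1 / 2 : ℝ) • (x j + x k) - x l) +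
      (1 / 2 : ℝ) • (x j - x k) by module]
    refine (norm_add_le _ _).trans ?_
    linarith
  have h2 : ‖x k - x l‖ ≤ ‖x j - x k‖ := by
    rw [show x k - x l = ((1 / 2 : ℝ) • (x j + x k) - x l) -
      (1 / 2 : ℝ) • (x j - x k) by module]
    refine (norm_sub_le _ _).trans ?_
    linarith
  have h1' := pow_le_pow_left₀ (norm_nonneg _) h1 2
  have h2' := pow_le_pow_left₀ (norm_nonneg _) h2 2
  have hT : 0 < tripleSq j k l x := by
    unfold tripleSq
    positivity
  rw [← div_eq_mul_inv, inv_eq_one_div, div_le_div_iff₀ (by positivity) hT]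
  unfold tripleSq
  linarith

/-- Hardy's inequality: `|x_j - x_k|⁻²` is bounded by the kinetic energy. -/

theorem lintegral_inv_norm_sub_sq_le {φ : Config N → ℂ} (hφ : IsCore φ) {α : ℝ}
    (hα : Complex.exp ((α * Real.pi : ℝ) * Complex.I) ≠ 1) {j k : Fin N} (hjk : j ≠ k) :
    ∫⁻ x, ENNReal.ofReal ((‖x j - x k‖ ^ 2)⁻¹ * ‖φ x‖ ^ 2) ≤
      ENNReal.ofReal ((2 * 2 * pairConst α + N * 3) * kinetic α φ) := by
  have hC := pairConst_nonneg α
  have hkin := kinetic_nonneg α φ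
  set s : Finset (Fin N) := (Finset.univ.erase j).erase k with hs
  have hmeas : ∀ l, Measurable fun x => ENNReal.ofReal (3 * ((tripleSq j k l x)⁻¹ * ‖φ x‖ ^ 2)) :=
    fun l => (measurable_const.mul ((contDiff_tripleSq j k l).continuous.measurable.inv.mul
      (hφ.smooth.continuous.norm.pow 2).measurable)).ennreal_ofReal
  calc ∫⁻ x, ENNReal.ofReal ((‖x j - x k‖ ^ 2)⁻¹ * ‖φ x‖ ^ 2)
      ≤ ∫⁻ x, ((pairAlone j k).indicator
        (fun x => ENNReal.ofReal ((‖x j - x k‖ ^ 2)⁻¹ * ‖φ x‖ ^ 2)) x +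
          ∑ l ∈ s, ENNReal.ofReal (3 * ((tripleSq j k l x)⁻¹ * ‖φ x‖ ^ 2))) := by
        refine lintegral_mono fun x => ?_
        by_cases hx : x ∈ pairAlone j k
        · simp only [Set.indicator_of_mem hx]
          exact le_self_add
        -- Some third particle is in the disc; the single term of the sum that belongs to it already
        -- dominates.
        · simp only [pairAlone, Set.mem_ofPred_eq, not_forall, not_lt] at hx
          obtain ⟨l, hlj, hlk, hl⟩ := hx
          refine le_trans ?_ (le_add_left (Finset.single_le_sum (f := fun l =>
            ENNReal.ofReal (3 * ((tripleSq j k l x)⁻¹ * ‖φ x‖ ^ 2))) (fun _ _ => zero_le)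
            (show l ∈ s by simp [hs, hlj, hlk])))
          refine ENNReal.ofReal_le_ofReal ?_
          rw [← mul_assoc]
          exact mul_le_mul_of_nonneg_right (inv_norm_sub_sq_le hl) (by positivity)
    _ = (∫⁻ x, (pairAlone j k).indicator
        (fun x => ENNReal.ofReal ((‖x j - x k‖ ^ 2)⁻¹ * ‖φ x‖ ^ 2)) x) +
          ∑ l ∈ s, ∫⁻ x, ENNReal.ofReal (3 * ((tripleSq j k l x)⁻¹ * ‖φ x‖ ^ 2)) := by
        rw [lintegral_add_right _ (Finset.measurable_fun_sum _ fun l _ => hmeas l),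
          lintegral_finsetSum _ fun l _ => hmeas l]
    _ ≤ ENNReal.ofReal (2 * 2 * pairConst α * kinetic α φ) +
          ∑ l ∈ s, ENNReal.ofReal (3 * kinetic α φ) := by
        refine add_le_add ?_ (Finset.sum_le_sum fun l hl => ?_)
        · refine (lintegral_pairAlone_le hφ hα hjk).trans ?_
          have hi : ∀ a, Integrable fun x => ‖magneticDeriv α j a φ x‖ ^ 2 +
              ‖magneticDeriv α k a φ x‖ ^ 2 := fun a =>
            (hφ.isTest.magneticDeriv α j a).integrable_sq.add
              (hφ.isTest.magneticDeriv α k a).integrable_sq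
          rw [← ofReal_integral_eq_lintegral_ofReal
            ((integrable_finsetSum _ fun a _ => hi a).const_mul _)
            (Eventually.of_forall fun x => mul_nonneg hC (by positivity))]
          refine ENNReal.ofReal_le_ofReal ?_
          rw [integral_const_mul, integral_finsetSum _ fun a _ => hi a]
          have : ∀ a : Fin 2, ∫ x, (‖magneticDeriv α j a φ x‖ ^ 2 + ‖magneticDeriv α k a φ x‖ ^ 2) ≤
              2 * kinetic α φ := fun a => by
            rw [integral_add (hφ.isTest.magneticDeriv α j a).integrable_sq
              (hφ.isTest.magneticDeriv α k a).integrable_sq]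
            linarith [integral_le_kinetic α φ j a, integral_le_kinetic α φ k a]
          rw [Fin.sum_univ_two]
          nlinarith [this 0, this 1]
        · have hlk : l ≠ k := Finset.ne_of_mem_erase hl
          have hlj : l ≠ j := Finset.ne_of_mem_erase (Finset.mem_of_mem_erase hl)
          simp only [ENNReal.ofReal_mul (show (0 : ℝ) ≤ 3 by norm_num)]
          rw [lintegral_const_mul' _ _ ENNReal.ofReal_ne_top]
          exact mul_le_mul_right (lintegral_tripleSq_inv_le hφ.isTest α hjk hlk.symm hlj) _
    _ ≤ ENNReal.ofReal (2 * 2 * pairConst α * kinetic α φ) + ENNReal.ofReal (N * (3 * kinetic α φ)) := by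
        refine add_le_add le_rfl ?_
        rw [Finset.sum_const, nsmul_eq_mul, ENNReal.ofReal_mul (Nat.cast_nonneg N),
          ENNReal.ofReal_natCast]
        refine mul_le_mul_left ?_ _
        exact_mod_cast (Finset.card_le_univ s).trans (by simp)
    _ = _ := by
        rw [← ENNReal.ofReal_add (by positivity) (by positivity)]
        congr 1
        ring

/-! ### From the magnetic gradient to the gradient -/

theorem vectorPotential_sq_le (j : Fin N) (a : Fin 2) (x : Config N) :
    vectorPotential j x a ^ 2 ≤ N * ∑ k ∈ Finset.univ.erase j, (‖x j - x k‖ ^ 2)⁻¹ := by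
  rw [vectorPotential_apply]
  refine sq_sum_le_card_mul_sum_sq.trans ?_
  have hcard : ((Finset.univ.erase j).card : ℝ) ≤ N := by
    exact_mod_cast (Finset.card_le_univ _).trans (by simp)
  refine mul_le_mul hcard (Finset.sum_le_sum fun k _ => ?_)
    (Finset.sum_nonneg fun k _ => sq_nonneg _) (Nat.cast_nonneg N)
  have hp : perp (x j - x k) a ^ 2 ≤ ‖x j - x k‖ ^ 2 := by
    generalize x j - x k = v
    simp only [EuclideanSpace.norm_sq_eq, Fin.sum_univ_two, Real.norm_eq_abs, sq_abs]
    fin_cases a <;> simp only [Fin.zero_eta, Fin.mk_one, perp_zero_apply, perp_one_apply] <;>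
      nlinarith [sq_nonneg (v 0), sq_nonneg (v 1)]
  rw [mul_pow]
  by_cases h : ‖x j - x k‖ ^ 2 = 0
  · simp [h]
  · have h0 : 0 < ‖x j - x k‖ ^ 2 := lt_of_le_of_ne (by positivity) (Ne.symm h)
    rw [sq, mul_assoc]
    refine mul_le_of_le_one_right (by positivity) ?_
    rw [inv_mul_le_iff₀ h0, mul_one]
    exact hp

theorem partialDeriv_eq (α : ℝ) (j : Fin N) (a : Fin 2) (φ : Config N → ℂ) (x : Config N) :
    partialDeriv j a φ x = Complex.I * magneticDeriv α j a φ x -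
      Complex.I * ((α * vectorPotential j x a : ℝ) : ℂ) * φ x := by
  simp only [magneticDeriv]
  linear_combination (partialDeriv j a φ x) * Complex.I_mul_I

theorem norm_partialDeriv_sq_le (α : ℝ) (j : Fin N) (a : Fin 2) (φ : Config N → ℂ)
    (x : Config N) : ‖partialDeriv j a φ x‖ ^ 2 ≤ 2 * ‖magneticDeriv α j a φ x‖ ^ 2 +
      2 * (α * vectorPotential j x a) ^ 2 * ‖φ x‖ ^ 2 := by
  have h : ‖partialDeriv j a φ x‖ ≤ ‖magneticDeriv α j a φ x‖ +
      |α * vectorPotential j x a| * ‖φ x‖ := by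
    rw [partialDeriv_eq α]
    refine (norm_sub_le _ _).trans (le_of_eq ?_)
    rw [norm_mul, norm_mul, norm_mul, Complex.norm_I, one_mul, one_mul, Complex.norm_real,
      Real.norm_eq_abs]
  refine (pow_le_pow_left₀ (norm_nonneg _) h 2).trans ?_
  rw [← sq_abs (α * vectorPotential j x a)]
  nlinarith [sq_nonneg (‖magneticDeriv α j a φ x‖ - |α * vectorPotential j x a| * ‖φ x‖)]

theorem exp_mul_pi_ne_one {α : ℝ} (hα : ∀ q : ℤ, α ≠ 2 * (q : ℝ)) :
    Complex.exp ((α * Real.pi : ℝ) * Complex.I) ≠ 1 := by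
  intro h
  obtain ⟨n, hn⟩ := Complex.exp_eq_one_iff.1 h
  refine hα n ?_
  have h1 : ((α * Real.pi : ℝ) : ℂ) = ((2 * n * Real.pi : ℝ) : ℂ) := by
    refine mul_right_cancel₀ Complex.I_ne_zero (hn.trans ?_)
    push_cast
    ring
  exact mul_right_cancel₀ Real.pi_ne_zero (Complex.ofReal_injective h1)

/-- On the core the magnetic kinetic energy bounds the gradient. -/

theorem exists_integral_partialDeriv_sq_le (N : ℕ) {α : ℝ}
    (hα : ∀ q : ℤ, q ≠ 0 → α ≠ 2 * (q : ℝ)) :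
    ∃ C : ℝ, 0 ≤ C ∧ ∀ φ : Config N → ℂ, IsCore φ → ∀ j a,
      ∫ x, ‖partialDeriv j a φ x‖ ^ 2 ≤ C * kinetic α φ := by
  -- For α = 0 the twist e^{iαπ} is 1 and the pair inequality is unavailable, but the potential is
  -- absent.
  by_cases h0 : α = 0
  · refine ⟨1, zero_le_one, fun φ hφ j a => ?_⟩
    rw [one_mul]
    refine le_trans (le_of_eq ?_) (integral_le_kinetic α φ j a)
    simp [magneticDeriv, h0]
  have hexp : Complex.exp ((α * Real.pi : ℝ) * Complex.I) ≠ 1 := by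
    refine exp_mul_pi_ne_one fun q => ?_
    by_cases hq : q = 0
    · simpa [hq] using h0
    · exact hα q hq
  set C₁ := 2 * 2 * pairConst α + N * 3 with hC₁
  have hC₁0 : 0 ≤ C₁ := by
    have := pairConst_nonneg α
    positivity
  -- The 2 and the 2α² come from (a + b)² ≤ 2a² + 2b². One factor N is from Cauchy–Schwarz in
  -- `vectorPotential_sq_le`, the other bounds the number of particles k.
  refine ⟨2 + N * (2 * α ^ 2 * N * C₁), by positivity, fun φ hφ j a => ?_⟩
  have hkin := kinetic_nonneg α φ
  have hD := (hφ.isTest.magneticDeriv α j a).integrable_sq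
  rw [← ENNReal.ofReal_le_ofReal_iff (by positivity), ofReal_integral_eq_lintegral_ofReal
    (hφ.isTest.partialDeriv j a).integrable_sq (Eventually.of_forall fun x => by positivity)]
  have hmeas : ∀ k, Measurable fun x : Config N =>
      ENNReal.ofReal (2 * α ^ 2 * N * ((‖x j - x k‖ ^ 2)⁻¹ * ‖φ x‖ ^ 2)) := fun k =>
    (measurable_const.mul ((contDiff_norm_sub_sq j k).continuous.measurable.inv.mul
      (hφ.smooth.continuous.norm.pow 2).measurable)).ennreal_ofReal
  calc ∫⁻ x, ENNReal.ofReal (‖partialDeriv j a φ x‖ ^ 2)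
      ≤ ∫⁻ x, (ENNReal.ofReal (2 * ‖magneticDeriv α j a φ x‖ ^ 2) +
          ∑ k ∈ Finset.univ.erase j,
            ENNReal.ofReal (2 * α ^ 2 * N * ((‖x j - x k‖ ^ 2)⁻¹ * ‖φ x‖ ^ 2))) := by
        refine lintegral_mono fun x => ?_
        rw [← ENNReal.ofReal_sum_of_nonneg fun k _ => by positivity,
          ← ENNReal.ofReal_add (by positivity) (Finset.sum_nonneg fun k _ => by positivity)]
        refine ENNReal.ofReal_le_ofReal ((norm_partialDeriv_sq_le α j a φ x).trans ?_)
        refine add_le_add le_rfl ?_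
        rw [← Finset.mul_sum, ← Finset.sum_mul]
        have := mul_le_mul_of_nonneg_left (vectorPotential_sq_le j a x)
          (show 0 ≤ 2 * α ^ 2 * ‖φ x‖ ^ 2 by positivity)
        linarith
    _ = (∫⁻ x, ENNReal.ofReal (2 * ‖magneticDeriv α j a φ x‖ ^ 2)) +
          ∑ k ∈ Finset.univ.erase j,
            ∫⁻ x, ENNReal.ofReal (2 * α ^ 2 * N * ((‖x j - x k‖ ^ 2)⁻¹ * ‖φ x‖ ^ 2)) := by
        rw [lintegral_add_right _ (Finset.measurable_fun_sum _ fun l _ => hmeas l),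
          lintegral_finsetSum _ fun l _ => hmeas l]
    _ ≤ ENNReal.ofReal (2 * kinetic α φ) +
          ∑ k ∈ Finset.univ.erase j, ENNReal.ofReal (2 * α ^ 2 * N * (C₁ * kinetic α φ)) := by
        refine add_le_add ?_ (Finset.sum_le_sum fun k hk => ?_)
        · rw [← ofReal_integral_eq_lintegral_ofReal (hD.const_mul 2)
            (Eventually.of_forall fun x => by positivity), integral_const_mul]
          exact ENNReal.ofReal_le_ofReal
            (mul_le_mul_of_nonneg_left (integral_le_kinetic α φ j a) zero_le_two)
        · have hjk : j ≠ k := (Finset.ne_of_mem_erase hk).symm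
          simp only [ENNReal.ofReal_mul (show 0 ≤ 2 * α ^ 2 * N by positivity)]
          rw [lintegral_const_mul' _ _ ENNReal.ofReal_ne_top]
          exact mul_le_mul_right (lintegral_inv_norm_sub_sq_le hφ hexp hjk) _
    _ ≤ ENNReal.ofReal (2 * kinetic α φ) +
          ENNReal.ofReal (N * (2 * α ^ 2 * N * (C₁ * kinetic α φ))) := by
        refine add_le_add le_rfl ?_
        rw [Finset.sum_const, nsmul_eq_mul, ENNReal.ofReal_mul (Nat.cast_nonneg N),
          ENNReal.ofReal_natCast]
        refine mul_le_mul_left ?_ _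
        exact_mod_cast (Finset.card_le_univ _).trans (by simp)
    _ = _ := by
        rw [← ENNReal.ofReal_add (by positivity) (by positivity)]
        congr 1
        ring

/-! ### Compact approximation by averages over cubes -/

theorem enorm_integral_sq_le {X : Type*} [MeasurableSpace X] (μ : Measure X) {f : X → ℂ}
    (hf : AEStronglyMeasurable f μ) : ‖∫ x, f x ∂μ‖ₑ ^ 2 ≤ μ Set.univ * ∫⁻ x, ‖f x‖ₑ ^ 2 ∂μ := by
  have h1 : ∫⁻ x, ‖f x‖ₑ ∂μ ≤
      (∫⁻ x, ‖f x‖ₑ ^ (2 : ℝ) ∂μ) ^ (1 / 2 : ℝ) * (∫⁻ _, 1 ^ (2 : ℝ) ∂μ) ^ (1 / 2 : ℝ) := by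
    have := ENNReal.lintegral_mul_le_Lp_mul_Lq μ Real.HolderConjugate.two_two hf.enorm
      (aemeasurable_const (b := (1 : ENNReal)))
    simpa using this
  calc ‖∫ x, f x ∂μ‖ₑ ^ 2 ≤ (∫⁻ x, ‖f x‖ₑ ∂μ) ^ 2 :=
        pow_le_pow_left₀ zero_le (enorm_integral_le_lintegral_enorm f) 2
    _ ≤ ((∫⁻ x, ‖f x‖ₑ ^ (2 : ℝ) ∂μ) ^ (1 / 2 : ℝ) * (∫⁻ _, 1 ^ (2 : ℝ) ∂μ) ^ (1 / 2 : ℝ)) ^ 2 :=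
        pow_le_pow_left₀ zero_le h1 2
    _ = μ Set.univ * ∫⁻ x, ‖f x‖ₑ ^ 2 ∂μ := by
        rw [mul_pow, ← ENNReal.rpow_natCast, ← ENNReal.rpow_natCast, ← ENNReal.rpow_mul,
          ← ENNReal.rpow_mul, mul_comm]
        simp

theorem IsTest.lintegral_enorm_sq {u : Config N → ℂ} (hu : IsTest u) :
    ∫⁻ x, ‖u x‖ₑ ^ 2 = ENNReal.ofReal (∫ x, ‖u x‖ ^ 2) := by
  rw [ofReal_integral_eq_lintegral_ofReal hu.integrable_sq
    (Eventually.of_forall fun x => by positivity)]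
  refine lintegral_congr fun x => ?_
  rw [ENNReal.ofReal_pow (norm_nonneg _), ofReal_norm]

/-- Write the difference as the integral of the derivative along the segment, apply Cauchy–Schwarz
in the parameter, and use translation invariance for each value of the parameter. -/
theorem IsTest.lintegral_translate_sub_le {u : Config N → ℂ} (hu : IsTest u) (h : Config N) :
    ∫⁻ x, ‖u (x + h) - u x‖ₑ ^ 2 ≤ ∫⁻ x, ‖fderiv ℝ u x h‖ₑ ^ 2 := by
  have hc : Continuous fun x => fderiv ℝ u x h :=
    (hu.smooth.continuous_fderiv (by simp)).clm_apply continuous_const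
  have hc2 : Continuous fun p : Config N × ℝ => fderiv ℝ u (p.1 + p.2 • h) h :=
    hc.comp (continuous_fst.add (continuous_snd.smul continuous_const))
  have hpt : ∀ x, ‖u (x + h) - u x‖ₑ ^ 2 ≤
      ∫⁻ t in Set.Ioc (0 : ℝ) 1, ‖fderiv ℝ u (x + t • h) h‖ₑ ^ 2 := by
    intro x
    have hd : ∀ t : ℝ, HasDerivAt (fun t : ℝ => u (x + t • h)) (fderiv ℝ u (x + t • h) h) t := by
      intro t
      have h1 : HasDerivAt (fun t : ℝ => x + t • h) h t := by
        simpa using ((hasDerivAt_id t).smul_const h).const_add x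
      exact (hu.differentiable (x + t • h)).hasFDerivAt.comp_hasDerivAt t h1
    have hct : Continuous fun t : ℝ => fderiv ℝ u (x + t • h) h :=
      hc.comp (continuous_const.add (continuous_id.smul continuous_const))
    have e := intervalIntegral.integral_eq_sub_of_hasDerivAt (fun t _ => hd t)
      (hct.intervalIntegrable 0 1)
    simp only [one_smul, zero_smul, add_zero] at e
    rw [← e, intervalIntegral.integral_of_le zero_le_one]
    refine (enorm_integral_sq_le _ hct.aestronglyMeasurable).trans (le_of_eq ?_)
    simp
  refine (lintegral_mono hpt).trans ?_
  rw [lintegral_lintegral_swap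
    (f := fun (x : Config N) (t : ℝ) => ‖fderiv ℝ u (x + t • h) h‖ₑ ^ 2)
    (hc2.enorm.measurable.pow_const 2).aemeasurable]
  have ht : ∀ t : ℝ, ∫⁻ x, ‖fderiv ℝ u (x + t • h) h‖ₑ ^ 2 = ∫⁻ x, ‖fderiv ℝ u x h‖ₑ ^ 2 :=
    fun t => lintegral_add_right_eq_self (fun x : Config N => ‖fderiv ℝ u x h‖ₑ ^ 2) (t • h)
  simp [ht]

/-- The vectors whose coordinates are bounded by `δ`. -/

def coordBox (N : ℕ) (δ : ℝ) : Set (Config N) := {h | ∀ j a, |h j a| ≤ δ}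

theorem eq_sum_unitVec (h : Config N) : h = ∑ p : Fin N × Fin 2, h p.1 p.2 • unitVec p.1 p.2 := by
  funext i
  ext b
  rw [Finset.sum_apply, WithLp.ofLp_sum, Finset.sum_apply, Finset.sum_eq_single (i, b)]
  · simp [unitVec_apply]
  · intro p _ hp
    simp only [Pi.smul_apply, PiLp.smul_apply, unitVec_apply, smul_eq_mul]
    by_cases h1 : i = p.1
    · by_cases h2 : b = p.2
      · exact absurd (Prod.ext h1.symm h2.symm) hp
      · simp [h2]
    · simp [h1]
  · simp

theorem norm_fderiv_sq_le (u : Config N → ℂ) (x : Config N) {h : Config N} {δ : ℝ}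
    (hh : h ∈ coordBox N δ) : ‖fderiv ℝ u x h‖ ^ 2 ≤
      (2 * N * δ ^ 2) * ∑ p : Fin N × Fin 2, ‖partialDeriv p.1 p.2 u x‖ ^ 2 := by
  have h1 : ‖fderiv ℝ u x h‖ ≤ ∑ p : Fin N × Fin 2, |h p.1 p.2| * ‖partialDeriv p.1 p.2 u x‖ := by
    conv_lhs => rw [eq_sum_unitVec h]
    rw [map_sum]
    refine (norm_sum_le _ _).trans (Finset.sum_le_sum fun p _ => ?_)
    rw [map_smul, norm_smul, Real.norm_eq_abs]
    rfl
  calc ‖fderiv ℝ u x h‖ ^ 2 ≤ (∑ p : Fin N × Fin 2, |h p.1 p.2| * ‖partialDeriv p.1 p.2 u x‖) ^ 2 :=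
        pow_le_pow_left₀ (norm_nonneg _) h1 2
    _ ≤ (Finset.univ : Finset (Fin N × Fin 2)).card *
          ∑ p : Fin N × Fin 2, (|h p.1 p.2| * ‖partialDeriv p.1 p.2 u x‖) ^ 2 :=
        sq_sum_le_card_mul_sum_sq
    _ ≤ (2 * N) * ∑ p : Fin N × Fin 2, δ ^ 2 * ‖partialDeriv p.1 p.2 u x‖ ^ 2 := by
        have hcard : ((Finset.univ : Finset (Fin N × Fin 2)).card : ℝ) = 2 * N := by
          simp [Fintype.card_prod, mul_comm]
        rw [hcard]
        refine mul_le_mul_of_nonneg_left (Finset.sum_le_sum fun p _ => ?_) (by positivity)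
        rw [mul_pow]
        exact mul_le_mul_of_nonneg_right (pow_le_pow_left₀ (abs_nonneg _) (hh p.1 p.2) 2)
          (by positivity)
    _ = _ := by
        rw [← Finset.mul_sum]
        ring

theorem IsTest.lintegral_fderiv_sq_le {u : Config N → ℂ} (hu : IsTest u) {h : Config N} {δ : ℝ}
    (hh : h ∈ coordBox N δ) : ∫⁻ x, ‖fderiv ℝ u x h‖ₑ ^ 2 ≤
      ENNReal.ofReal ((2 * N * δ ^ 2) *
        ∑ p : Fin N × Fin 2, ∫ x, ‖Anyon.partialDeriv p.1 p.2 u x‖ ^ 2) := by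
  have hi : ∀ p : Fin N × Fin 2, Integrable fun x => ‖Anyon.partialDeriv p.1 p.2 u x‖ ^ 2 :=
    fun p => (hu.partialDeriv p.1 p.2).integrable_sq
  rw [← integral_finsetSum _ fun p _ => hi p, ← integral_const_mul,
    ofReal_integral_eq_lintegral_ofReal ((integrable_finsetSum _ fun p _ => hi p).const_mul _)
      (Eventually.of_forall fun x => by positivity)]
  refine lintegral_mono fun x => ?_
  rw [← ofReal_norm, ← ENNReal.ofReal_pow (norm_nonneg _)]
  exact ENNReal.ofReal_le_ofReal (norm_fderiv_sq_le u x hh)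

/-- The index of the cube of side `δ` that contains `x`. -/

def cubeIndex (δ : ℝ) (x : Config N) (p : Fin N × Fin 2) : ℤ := ⌊x p.1 p.2 / δ⌋

/-- The half-open cube of side `δ` with the index `k`. -/

def cube (δ : ℝ) (k : Fin N × Fin 2 → ℤ) : Set (Config N) := {x | cubeIndex δ x = k}

theorem measurable_cubeIndex (δ : ℝ) : Measurable (cubeIndex (N := N) δ) :=
  measurable_pi_lambda _ fun p =>
    Int.measurable_floor.comp ((contDiff_coord p.1 p.2).continuous.measurable.div_const δ)

theorem measurableSet_cube (δ : ℝ) (k : Fin N × Fin 2 → ℤ) : MeasurableSet (cube δ k) :=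
  measurable_cubeIndex δ (measurableSet_singleton k)

theorem measurableSet_coordBox (N : ℕ) (δ : ℝ) : MeasurableSet (coordBox N δ) := by
  have : coordBox N δ = ⋂ j, ⋂ a, {h | |h j a| ≤ δ} := by
    ext h
    simp [coordBox]
  rw [this]
  exact MeasurableSet.iInter fun j => MeasurableSet.iInter fun a =>
    measurableSet_le (contDiff_coord j a).continuous.abs.measurable measurable_const

theorem sub_mem_coordBox {δ : ℝ} (hδ : 0 < δ) {x y : Config N}
    (h : cubeIndex δ x = cubeIndex δ y) : y - x ∈ coordBox N δ := by
  intro j a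
  have h1 : ⌊x j a / δ⌋ = ⌊y j a / δ⌋ := congrFun h (j, a)
  have h2 := (Int.abs_sub_lt_one_of_floor_eq_floor h1).le
  rw [← sub_div, abs_div, abs_of_pos hδ, div_le_one hδ, abs_sub_comm] at h2
  exact h2

theorem cube_scaling {δ : ℝ} (k : Fin N × Fin 2 → ℤ) :
    cube δ k = (fun x => δ⁻¹ • x) ⁻¹' ((fun y => y +
      (fun j => WithLp.toLp 2 fun a => -(k (j, a) : ℝ))) ⁻¹' cube 1 (0 : Fin N × Fin 2 → ℤ)) := by
  ext x
  simp only [cube, Set.mem_ofPred_eq, Set.mem_preimage, funext_iff, cubeIndex]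
  refine forall_congr' fun p => ?_
  simp only [Pi.add_apply, PiLp.add_apply, Pi.smul_apply, PiLp.smul_apply, smul_eq_mul, div_one,
    Pi.zero_apply, ← sub_eq_add_neg, Int.floor_sub_intCast, sub_eq_zero]
  rw [div_eq_inv_mul]

/-- The factor by which the dilation by `δ` changes Lebesgue measure. -/

def dilation (N : ℕ) (δ : ℝ) : ENNReal :=
  ENNReal.ofReal |(δ⁻¹ ^ Module.finrank ℝ (Config N))⁻¹|

theorem dilation_ne_zero (N : ℕ) {δ : ℝ} (hδ : 0 < δ) : dilation N δ ≠ 0 := by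
  rw [dilation, Ne, ENNReal.ofReal_eq_zero, not_le]
  positivity

theorem dilation_ne_top (N : ℕ) (δ : ℝ) : dilation N δ ≠ ⊤ := ENNReal.ofReal_ne_top

/-- Volumes are never computed: cubes and boxes acquire the same factor under dilation, so their
ratio does not depend on δ. -/
theorem volume_cube {δ : ℝ} (hδ : 0 < δ) (k : Fin N × Fin 2 → ℤ) :
    volume (cube δ k) = dilation N δ * volume (cube 1 (0 : Fin N × Fin 2 → ℤ)) := by
  rw [cube_scaling, Measure.addHaar_preimage_smul volume (inv_ne_zero hδ.ne'),
    measure_preimage_add_right]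
  rfl

theorem volume_coordBox {δ : ℝ} (hδ : 0 < δ) :
    volume (coordBox N δ) = dilation N δ * volume (coordBox N 1) := by
  have : coordBox N δ = (fun x => δ⁻¹ • x) ⁻¹' coordBox N 1 := by
    ext x
    simp only [coordBox, Set.mem_ofPred_eq, Set.mem_preimage, Pi.smul_apply, PiLp.smul_apply,
      smul_eq_mul, abs_mul, abs_inv, abs_of_pos hδ]
    simp only [inv_mul_le_iff₀ hδ, mul_one]
  rw [this, Measure.addHaar_preimage_smul volume (inv_ne_zero hδ.ne')]
  rfl

theorem volume_coordBox_one_ne_top : volume (coordBox N 1) ≠ ⊤ := by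
  refine ((measure_mono ?_).trans_lt (measure_closedBall_lt_top (x := (0 : Config N))
    (r := 2))).ne
  intro x hx
  rw [mem_closedBall_zero_iff, pi_norm_le_iff_of_nonneg zero_le_two]
  intro i
  refine abs_le_of_sq_le_sq' ?_ zero_le_two |>.2
  rw [EuclideanSpace.norm_sq_eq, Fin.sum_univ_two, Real.norm_eq_abs, Real.norm_eq_abs]
  nlinarith [hx i 0, hx i 1, abs_nonneg (x i 0), abs_nonneg (x i 1)]

theorem volume_cube_one_ne_top : volume (cube 1 (0 : Fin N × Fin 2 → ℤ)) ≠ ⊤ := by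
  refine ((measure_mono fun x hx => ?_).trans_lt (volume_coordBox_one_ne_top (N := N)).lt_top).ne
  have h0 : cubeIndex 1 (0 : Config N) = cubeIndex 1 x := by
    rw [show cubeIndex 1 x = 0 from hx]
    funext p
    simp [cubeIndex]
  simpa using sub_mem_coordBox one_pos h0

/-- Countably many cubes of this same volume cover the whole space. -/
theorem volume_cube_one_ne_zero : volume (cube 1 (0 : Fin N × Fin 2 → ℤ)) ≠ 0 := by
  intro h0
  have h1 : volume (⋃ k, cube (N := N) 1 k) = 0 :=
    measure_iUnion_null fun k => by rw [volume_cube one_pos, h0, mul_zero]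
  have h2 : (⋃ k, cube (N := N) 1 k) = Set.univ :=
    Set.eq_univ_of_forall fun x => Set.mem_iUnion.2 ⟨cubeIndex 1 x, rfl⟩
  rw [h2] at h1
  exact (Measure.measure_univ_ne_zero.2 (NeZero.ne (volume : Measure (Config N)))) h1

theorem volume_cube_ne_zero {δ : ℝ} (hδ : 0 < δ) (k : Fin N × Fin 2 → ℤ) :
    volume (cube δ k) ≠ 0 := by
  rw [volume_cube hδ]
  exact mul_ne_zero (dilation_ne_zero N hδ) volume_cube_one_ne_zero

theorem volume_cube_ne_top {δ : ℝ} (hδ : 0 < δ) (k : Fin N × Fin 2 → ℤ) :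
    volume (cube δ k) ≠ ⊤ := by
  rw [volume_cube hδ]
  exact ENNReal.mul_ne_top (dilation_ne_top N δ) volume_cube_one_ne_top

/-- The average of `u` over a cube. -/

def cubeAverage (δ : ℝ) (u : Config N → ℂ) (k : Fin N × Fin 2 → ℤ) : ℂ :=
  ((volume (cube δ k)).toReal : ℂ)⁻¹ * ∫ y in cube δ k, u y

/-- Jensen's inequality: u(x) minus the average is the average of u(x) - u(y). -/
theorem IsTest.enorm_sub_cubeAverage_sq_le {u : Config N → ℂ} (hu : IsTest u) {δ : ℝ} (hδ : 0 < δ)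
    (k : Fin N × Fin 2 → ℤ) (x : Config N) :
    ‖u x - cubeAverage δ u k‖ₑ ^ 2 ≤
      (volume (cube δ k))⁻¹ * ∫⁻ y in cube δ k, ‖u x - u y‖ₑ ^ 2 := by
  set v := volume (cube δ k) with hv
  have hv0 : v ≠ 0 := volume_cube_ne_zero hδ k
  have hvt : v ≠ ⊤ := volume_cube_ne_top hδ k
  have hr : 0 < v.toReal := ENNReal.toReal_pos hv0 hvt
  have hint : IntegrableOn u (cube δ k) volume :=
    (hu.continuous.integrable_of_hasCompactSupport hu.compact).integrableOn
  have hconst : IntegrableOn (fun _ => u x) (cube δ k) volume := integrableOn_const hvt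
  have e : u x - cubeAverage δ u k = (v.toReal : ℂ)⁻¹ * ∫ y in cube δ k, (u x - u y) := by
    rw [integral_sub hconst hint, setIntegral_const, cubeAverage, ← hv, mul_sub, measureReal_def,
      ← hv, Complex.real_smul, ← mul_assoc, inv_mul_cancel₀ (by exact_mod_cast hr.ne'), one_mul]
  have hn : ‖(v.toReal : ℂ)⁻¹‖ₑ = v⁻¹ := by
    rw [← ofReal_norm, norm_inv, Complex.norm_real, Real.norm_eq_abs, abs_of_pos hr,
      ENNReal.ofReal_inv_of_pos hr, ENNReal.ofReal_toReal hvt]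
  rw [e, enorm_mul, mul_pow, hn]
  refine (mul_le_mul_right (enorm_integral_sq_le (volume.restrict (cube δ k))
    (continuous_const.sub hu.continuous).aestronglyMeasurable) _).trans (le_of_eq ?_)
  rw [Measure.restrict_apply_univ, ← hv, sq, ← mul_assoc, mul_assoc v⁻¹,
    ENNReal.inv_mul_cancel hv0 hvt, mul_one]
  rfl

/-- With y = x + h, the order of integration is exchanged, and the translation estimate applies for
each fixed h in the box. -/
theorem IsTest.lintegral_coordBox_le {u : Config N → ℂ} (hu : IsTest u) {δ : ℝ} :
    ∫⁻ x, ∫⁻ y, (coordBox N δ).indicator (fun _ => ‖u x - u y‖ₑ ^ 2) (y - x) ≤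
      volume (coordBox N δ) * ENNReal.ofReal ((2 * N * δ ^ 2) *
        ∑ p : Fin N × Fin 2, ∫ x, ‖Anyon.partialDeriv p.1 p.2 u x‖ ^ 2) := by
  have h1 : ∀ x, ∫⁻ y, (coordBox N δ).indicator (fun _ => ‖u x - u y‖ₑ ^ 2) (y - x) =
      ∫⁻ h, (coordBox N δ).indicator (fun h => ‖u (x + h) - u x‖ₑ ^ 2) h := by
    intro x
    rw [← lintegral_add_left_eq_self _ x]
    refine lintegral_congr fun h => ?_
    rw [add_sub_cancel_left]
    simp only [Set.indicator]
    rw [enorm_sub_rev]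
  simp only [h1]
  have hm : Measurable (Function.uncurry fun (x h : Config N) =>
      (coordBox N δ).indicator (fun h => ‖u (x + h) - u x‖ₑ ^ 2) h) := by
    have hc : Continuous fun p : Config N × Config N => u (p.1 + p.2) - u p.1 :=
      (hu.continuous.comp (continuous_fst.add continuous_snd)).sub
        (hu.continuous.comp continuous_fst)
    have := (hc.enorm.measurable.pow_const 2).indicator
      ((measurableSet_coordBox N δ).preimage measurable_snd)
    exact this
  rw [lintegral_lintegral_swap hm.aemeasurable]
  have h2 : ∀ h, ∫⁻ x, (coordBox N δ).indicator (fun h => ‖u (x + h) - u x‖ₑ ^ 2) h ≤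
      (coordBox N δ).indicator (fun _ => ENNReal.ofReal ((2 * N * δ ^ 2) *
        ∑ p : Fin N × Fin 2, ∫ x, ‖Anyon.partialDeriv p.1 p.2 u x‖ ^ 2)) h := by
    intro h
    by_cases hh : h ∈ coordBox N δ
    · simp only [Set.indicator_of_mem hh]
      exact (hu.lintegral_translate_sub_le h).trans (hu.lintegral_fderiv_sq_le hh)
    · simp [Set.indicator_of_notMem hh]
  refine (lintegral_mono h2).trans (le_of_eq ?_)
  rw [lintegral_indicator_const (measurableSet_coordBox N δ), mul_comm]

/-- The ratio of the volumes of `[-1, 1]^{2N}` and `[0, 1)^{2N}`. -/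

def boxRatio (N : ℕ) : ENNReal :=
  (volume (cube 1 (0 : Fin N × Fin 2 → ℤ)))⁻¹ * volume (coordBox N 1)

theorem boxRatio_ne_top : boxRatio N ≠ ⊤ :=
  ENNReal.mul_ne_top (ENNReal.inv_ne_top.2 volume_cube_one_ne_zero) volume_coordBox_one_ne_top

/-- The cubes that are averaged over. -/

def cubeRange (N M : ℕ) : Finset (Fin N × Fin 2 → ℤ) :=
  Finset.Icc (fun _ => -(M : ℤ)) (fun _ => (M : ℤ))

/-- The piecewise constant approximation of `u` by its averages over finitely many cubes. -/

def cubeApprox (δ : ℝ) (M : ℕ) (u : Config N → ℂ) (x : Config N) : ℂ :=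
  ∑ k ∈ cubeRange N M, (cube δ k).indicator (fun _ => cubeAverage δ u k) x

theorem cubeApprox_of_mem (δ : ℝ) {M : ℕ} (u : Config N → ℂ) {x : Config N}
    (hx : cubeIndex δ x ∈ cubeRange N M) :
    cubeApprox δ M u x = cubeAverage δ u (cubeIndex δ x) := by
  rw [cubeApprox, Finset.sum_eq_single_of_mem _ hx]
  · exact Set.indicator_of_mem (show x ∈ cube δ (cubeIndex δ x) from rfl) _
  · intro k _ hk
    exact Set.indicator_of_notMem (fun h : x ∈ cube δ k => hk h.symm) _

theorem cubeApprox_of_notMem (δ : ℝ) {M : ℕ} (u : Config N → ℂ) {x : Config N}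
    (hx : cubeIndex δ x ∉ cubeRange N M) : cubeApprox δ M u x = 0 :=
  Finset.sum_eq_zero fun k hk =>
    Set.indicator_of_notMem (fun h : x ∈ cube δ k => hx ((show cubeIndex δ x = k from h) ▸ hk)) _

/-- A Chebyshev weight: outside the finite range of cubes some coordinate has modulus at least Mδ.
-/
theorem one_le_of_cubeIndex_notMem {δ : ℝ} (hδ : 0 < δ) {M : ℕ} (hM : 0 < M) {x : Config N}
    (hx : cubeIndex δ x ∉ cubeRange N M) :
    1 ≤ ((M * δ) ^ 2)⁻¹ * ∑ p : Fin N × Fin 2, x p.1 p.2 ^ 2 := by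
  have hMδ : 0 < (M : ℝ) * δ := by positivity
  obtain ⟨p, hp⟩ : ∃ p : Fin N × Fin 2, M * δ ≤ |x p.1 p.2| := by
    by_contra hcon
    push Not at hcon
    refine hx (Finset.mem_Icc.2 ⟨fun p => ?_, fun p => ?_⟩)
    · rw [cubeIndex, Int.le_floor, le_div_iff₀ hδ]
      push_cast
      linarith [(abs_lt.1 (hcon p)).1]
    · have h1 : x p.1 p.2 / δ < M := by
        rw [div_lt_iff₀ hδ]
        exact (abs_lt.1 (hcon p)).2
      have h2 := (Int.floor_le (x p.1 p.2 / δ)).trans h1.le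
      show ⌊x p.1 p.2 / δ⌋ ≤ (M : ℤ)
      rw [← Int.cast_le (R := ℝ), Int.cast_natCast]
      exact h2
  rw [inv_mul_eq_div, one_le_div (by positivity)]
  refine (pow_le_pow_left₀ hMδ.le hp 2).trans ?_
  rw [sq_abs]
  exact Finset.single_le_sum (f := fun p : Fin N × Fin 2 => x p.1 p.2 ^ 2)
    (fun _ _ => sq_nonneg _) (Finset.mem_univ p)

/-- Inside the range, points of one cube differ by a vector of `coordBox`, so the average is
compared over the larger, translation-invariant set. Outside it the approximation is 0 and the
second moment takes over. -/
theorem IsTest.enorm_sub_cubeApprox_le {u : Config N → ℂ} (hu : IsTest u) {δ : ℝ} (hδ : 0 < δ)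
    {M : ℕ} (hM : 0 < M) (x : Config N) :
    ‖u x - cubeApprox δ M u x‖ₑ ^ 2 ≤
      (dilation N δ * volume (cube 1 (0 : Fin N × Fin 2 → ℤ)))⁻¹ *
        (∫⁻ y, (coordBox N δ).indicator (fun _ => ‖u x - u y‖ₑ ^ 2) (y - x)) +
      ENNReal.ofReal (((M * δ) ^ 2)⁻¹ * ∑ p : Fin N × Fin 2, x p.1 p.2 ^ 2 * ‖u x‖ ^ 2) := by
  by_cases hx : cubeIndex δ x ∈ cubeRange N M
  · refine le_add_right ?_
    rw [cubeApprox_of_mem δ u hx]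
    refine (hu.enorm_sub_cubeAverage_sq_le hδ _ x).trans ?_
    rw [volume_cube hδ]
    refine mul_le_mul_right ?_ _
    rw [← lintegral_indicator (measurableSet_cube δ _)]
    refine lintegral_mono fun y => ?_
    by_cases hy : y ∈ cube δ (cubeIndex δ x)
    · have hb : y - x ∈ coordBox N δ := sub_mem_coordBox hδ (Eq.symm hy)
      rw [Set.indicator_of_mem hy, Set.indicator_of_mem hb]
    · rw [Set.indicator_of_notMem hy]
      exact zero_le
  · refine le_add_left ?_
    rw [cubeApprox_of_notMem δ u hx, sub_zero, ← ofReal_norm, ← ENNReal.ofReal_pow (norm_nonneg _)]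
    refine ENNReal.ofReal_le_ofReal ?_
    rw [← Finset.sum_mul, ← mul_assoc]
    exact le_mul_of_one_le_left (by positivity) (one_le_of_cubeIndex_notMem hδ hM hx)

theorem IsTest.lintegral_sub_cubeApprox_le {u : Config N → ℂ} (hu : IsTest u) {δ : ℝ} (hδ : 0 < δ)
    {M : ℕ} (hM : 0 < M) :
    ∫⁻ x, ‖u x - cubeApprox δ M u x‖ₑ ^ 2 ≤ ENNReal.ofReal
      ((boxRatio N).toReal * (2 * N * δ ^ 2) *
          (∑ p : Fin N × Fin 2, ∫ x, ‖Anyon.partialDeriv p.1 p.2 u x‖ ^ 2) +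
        ((M * δ) ^ 2)⁻¹ * ∑ p : Fin N × Fin 2, ∫ x, x p.1 p.2 ^ 2 * ‖u x‖ ^ 2) := by
  have hi : ∀ p : Fin N × Fin 2, Integrable fun x => x p.1 p.2 ^ 2 * ‖u x‖ ^ 2 :=
    fun p => hu.integrable_norm_sq ((contDiff_coord p.1 p.2).continuous.pow 2)
  have hm : Measurable fun x => ENNReal.ofReal
      (((M * δ) ^ 2)⁻¹ * ∑ p : Fin N × Fin 2, x p.1 p.2 ^ 2 * ‖u x‖ ^ 2) := by
    refine (measurable_const.mul (Finset.measurable_fun_sum _ fun p _ => ?_)).ennreal_ofReal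
    exact (((contDiff_coord p.1 p.2).continuous.pow 2).mul (hu.continuous.norm.pow 2)).measurable
  have hG : 0 ≤ ∑ p : Fin N × Fin 2, ∫ x, ‖Anyon.partialDeriv p.1 p.2 u x‖ ^ 2 :=
    Finset.sum_nonneg fun p _ => integral_nonneg fun x => by positivity
  have hV : 0 ≤ ∑ p : Fin N × Fin 2, ∫ x, x p.1 p.2 ^ 2 * ‖u x‖ ^ 2 :=
    Finset.sum_nonneg fun p _ => integral_nonneg fun x => by positivity
  refine (lintegral_mono (hu.enorm_sub_cubeApprox_le hδ hM)).trans ?_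
  rw [lintegral_add_right _ hm, ENNReal.ofReal_add (by positivity) (by positivity)]
  refine add_le_add ?_ ?_
  · have hne : (dilation N δ * volume (cube 1 (0 : Fin N × Fin 2 → ℤ)))⁻¹ ≠ ⊤ := by
      refine ENNReal.inv_ne_top.2 (mul_ne_zero (dilation_ne_zero N hδ) volume_cube_one_ne_zero)
    rw [lintegral_const_mul' _ _ hne]
    refine (mul_le_mul_right hu.lintegral_coordBox_le _).trans (le_of_eq ?_)
    rw [mul_assoc (boxRatio N).toReal, ENNReal.ofReal_mul ENNReal.toReal_nonneg,
      ENNReal.ofReal_toReal boxRatio_ne_top, ← mul_assoc]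
    congr 1
    rw [volume_coordBox hδ, boxRatio, ENNReal.mul_inv (Or.inl (dilation_ne_zero N hδ))
      (Or.inl (dilation_ne_top N δ))]
    calc _ = ((dilation N δ)⁻¹ * dilation N δ) *
          ((volume (cube 1 (0 : Fin N × Fin 2 → ℤ)))⁻¹ * volume (coordBox N 1)) := by ring
      _ = _ := by
        rw [ENNReal.inv_mul_cancel (dilation_ne_zero N hδ) (dilation_ne_top N δ), one_mul]
  · rw [← ofReal_integral_eq_lintegral_ofReal
      ((integrable_finsetSum _ fun p _ => hi p).const_mul _)
      (Eventually.of_forall fun x => by positivity), integral_const_mul,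
      integral_finsetSum _ fun p _ => hi p]

theorem L2_enorm_sq (f : L2 N) : ‖f‖ₑ ^ 2 = ∫⁻ x, ‖f x‖ₑ ^ 2 := by
  rw [Lp.enorm_def]
  have := eLpNorm_nnreal_pow_eq_lintegral (f := f) (μ := (volume : Measure (Config N)))
    (p := 2) two_ne_zero
  simpa using this

/-- The finite-rank operator of averaging over finitely many cubes. -/

def cubeOp {δ : ℝ} (hδ : 0 < δ) (M : ℕ) : L2 N →L[ℂ] L2 N :=
  ∑ k ∈ cubeRange N M, ((volume (cube δ k)).toReal : ℂ)⁻¹ •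
    (innerSL ℂ (indicatorConstLp 2 (measurableSet_cube δ k) (volume_cube_ne_top hδ k)
      (1 : ℂ))).smulRight
      (indicatorConstLp 2 (measurableSet_cube δ k) (volume_cube_ne_top hδ k) (1 : ℂ))

theorem isCompactOperator_cubeOp {δ : ℝ} (hδ : 0 < δ) (M : ℕ) :
    IsCompactOperator (cubeOp (N := N) hδ M) := by
  have h : cubeOp (N := N) hδ M ∈ compactOperator (RingHom.id ℂ) (L2 N) (L2 N) := by
    -- Each summand has rank one: it factors through ℂ.
    refine Submodule.sum_mem _ fun k _ => Submodule.smul_mem _ _ ?_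
    have hc : IsCompactOperator
        ((ContinuousLinearMap.toSpanSingleton ℂ (indicatorConstLp 2 (measurableSet_cube δ k)
          (volume_cube_ne_top hδ k) (1 : ℂ))) : ℂ → L2 N) :=
      isCompactOperator_of_locallyCompactSpace_rng
        (ContinuousLinearMap.toSpanSingleton ℂ _)
    exact hc.comp_clm (innerSL ℂ (indicatorConstLp 2 (measurableSet_cube δ k)
      (volume_cube_ne_top hδ k) (1 : ℂ)))
  exact h

theorem coeFn_cubeOp {δ : ℝ} (hδ : 0 < δ) (M : ℕ) {u : Config N → ℂ} (hu : IsTest u) :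
    cubeOp hδ M (hu.memLp.toLp u) =ᵐ[volume] cubeApprox δ M u := by
  have e : cubeOp hδ M (hu.memLp.toLp u) = ∑ k ∈ cubeRange N M, cubeAverage δ u k •
      indicatorConstLp 2 (measurableSet_cube δ k) (volume_cube_ne_top hδ k) (1 : ℂ) := by
    simp only [cubeOp, FunLike.coe_sum, Finset.sum_apply,
      smul_apply, ContinuousLinearMap.smulRight_apply, innerSL_apply_apply,
      smul_smul]
    refine Finset.sum_congr rfl fun k _ => ?_
    rw [L2.inner_indicatorConstLp_one, cubeAverage,
      setIntegral_congr_ae (measurableSet_cube δ k)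
        (hu.memLp.coeFn_toLp.mono fun x hx _ => hx)]
  rw [e]
  have h1 := Lp.coeFn_finsetSum (cubeRange N M) (fun k => cubeAverage δ u k •
      indicatorConstLp 2 (measurableSet_cube δ k) (volume_cube_ne_top hδ k) (1 : ℂ))
  have h2 : ∀ᵐ x, ∀ k ∈ cubeRange N M, (cubeAverage δ u k •
      indicatorConstLp 2 (measurableSet_cube δ k) (volume_cube_ne_top hδ k) (1 : ℂ) : L2 N) x =
      (cube δ k).indicator (fun _ => cubeAverage δ u k) x := by
    rw [eventually_all_finset]
    intro k _
    filter_upwards [Lp.coeFn_smul (cubeAverage δ u k)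
      (indicatorConstLp 2 (measurableSet_cube δ k) (volume_cube_ne_top hδ k) (1 : ℂ)),
      indicatorConstLp_coeFn (p := 2) (hs := measurableSet_cube δ k)
        (hμs := volume_cube_ne_top hδ k) (c := (1 : ℂ))] with x h3 h4
    rw [h3, Pi.smul_apply, h4]
    by_cases hx : x ∈ cube δ k
    · simp [hx]
    · simp [hx]
  filter_upwards [h1, h2] with x h3 h4
  rw [h3, Finset.sum_apply, cubeApprox]
  exact Finset.sum_congr rfl h4

/-- Compactness of the embedding of `H¹_V` into `L²`, in terms of finite-rank approximations. -/

theorem exists_compact_approx (N : ℕ) {η : ℝ} (hη : 0 < η) :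
    ∃ P : L2 N →L[ℂ] L2 N, IsCompactOperator P ∧ ∀ (u : Config N → ℂ) (hu : IsTest u),
      ‖hu.memLp.toLp u - P (hu.memLp.toLp u)‖ ^ 2 ≤
        η * ∑ p : Fin N × Fin 2,
          ((∫ x, ‖partialDeriv p.1 p.2 u x‖ ^ 2) + ∫ x, x p.1 p.2 ^ 2 * ‖u x‖ ^ 2) := by
  -- The side δ is chosen first to make the gradient term small, then the number of cubes to make
  -- the tail small. The 1 in the denominator guards against c = 0.
  obtain ⟨δ, hδ, hδη⟩ : ∃ δ : ℝ, 0 < δ ∧ (boxRatio N).toReal * (2 * N * δ ^ 2) ≤ η := by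
    set c := (boxRatio N).toReal * (2 * N) with hc
    have hc0 : 0 ≤ c := by positivity
    refine ⟨Real.sqrt (η / (c + 1)), Real.sqrt_pos.2 (by positivity), ?_⟩
    rw [Real.sq_sqrt (by positivity), ← mul_assoc, ← hc, mul_div_assoc',
      div_le_iff₀ (by positivity)]
    nlinarith
  obtain ⟨M, hM⟩ : ∃ M : ℕ, 0 < M ∧ ((M * δ) ^ 2)⁻¹ ≤ η := by
    obtain ⟨M, hM⟩ := exists_nat_gt (Real.sqrt η⁻¹ / δ)
    have h0 : 0 ≤ Real.sqrt η⁻¹ / δ := by positivity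
    refine ⟨M, by exact_mod_cast h0.trans_lt hM, ?_⟩
    rw [div_lt_iff₀ hδ] at hM
    refine inv_le_of_inv_le₀ hη ?_
    calc η⁻¹ = Real.sqrt η⁻¹ ^ 2 := (Real.sq_sqrt (by positivity)).symm
      _ ≤ _ := pow_le_pow_left₀ (Real.sqrt_nonneg _) hM.le 2
  refine ⟨cubeOp hδ M, isCompactOperator_cubeOp hδ M, fun u hu => ?_⟩
  have hG : 0 ≤ ∑ p : Fin N × Fin 2, ∫ x, ‖partialDeriv p.1 p.2 u x‖ ^ 2 :=
    Finset.sum_nonneg fun p _ => integral_nonneg fun x => by positivity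
  have hV : 0 ≤ ∑ p : Fin N × Fin 2, ∫ x, x p.1 p.2 ^ 2 * ‖u x‖ ^ 2 :=
    Finset.sum_nonneg fun p _ => integral_nonneg fun x => by positivity
  rw [Finset.sum_add_distrib, mul_add]
  refine le_trans ?_ (add_le_add (mul_le_mul_of_nonneg_right hδη hG)
    (mul_le_mul_of_nonneg_right hM.2 hV))
  rw [← ENNReal.ofReal_le_ofReal_iff (by positivity), ENNReal.ofReal_pow (norm_nonneg _),
    ofReal_norm, L2_enorm_sq]
  refine le_trans (le_of_eq (lintegral_congr_ae ?_)) (hu.lintegral_sub_cubeApprox_le hδ hM.1)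
  filter_upwards [Lp.coeFn_sub (hu.memLp.toLp u) (cubeOp hδ M (hu.memLp.toLp u)),
    hu.memLp.coeFn_toLp, coeFn_cubeOp hδ M hu] with x h1 h2 h3
  rw [h1, Pi.sub_apply, h2, h3]

/-! ### The closed form as a subspace of a Hilbert space -/

theorem isTest_zero : IsTest (0 : Config N → ℂ) :=
  ⟨contDiff_const, HasCompactSupport.zero, by simp [tsupport]⟩

theorem IsTest.sum {ι : Type*} (s : Finset ι) {u : ι → Config N → ℂ} (h : ∀ i ∈ s, IsTest (u i)) :
    IsTest (∑ i ∈ s, u i) :=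
  Finset.sum_induction u IsTest (fun _ _ => IsTest.add) isTest_zero h

/-- The core as a vector space. -/

def coreSpace (N : ℕ) : Submodule ℂ (Config N → ℂ) where
  carrier := {u | IsCore u}
  zero_mem' := ⟨isTest_zero.smooth, isTest_zero.compact, isTest_zero.support, fun _ _ => rfl⟩
  add_mem' {u v} hu hv := by
    have h := hu.isTest.add hv.isTest
    exact ⟨h.smooth, h.compact, h.support, fun σ x => by simp [hu.symm σ x, hv.symm σ x]⟩
  smul_mem' c u hu := by
    have h := hu.isTest.const_mul c
    exact ⟨h.smooth, h.compact, h.support, fun σ x => by simp [hu.symm σ x]⟩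

theorem isTest_coe (u : coreSpace N) : IsTest (u : Config N → ℂ) := IsCore.isTest u.2

/-- The square roots of the coefficients of the trap. -/

def trapCoeff (ε : ℝ) : Fin 2 → ℝ := ![1, ε⁻¹]

/-- Multiplication by a coordinate, scaled as in the trap. -/

def trapMul (ε : ℝ) (p : Fin N × Fin 2) (u : Config N → ℂ) (x : Config N) : ℂ :=
  ((trapCoeff ε p.2 * x p.1 p.2 : ℝ) : ℂ) * u x

theorem IsTest.trapMul {u : Config N → ℂ} (hu : IsTest u) (ε : ℝ) (p : Fin N × Fin 2) :
    IsTest (trapMul ε p u) := hu.coord_mul _ _ _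

theorem trap_eq_sum (ε : ℝ) (v : Plane) : trap ε v = ∑ a, (trapCoeff ε a * v a) ^ 2 := by
  simp only [trap, trapCoeff, Fin.sum_univ_two, Matrix.cons_val_zero, Matrix.cons_val_one]
  ring

theorem IsTest.energy_eq {u : Config N → ℂ} (hu : IsTest u) (α ε : ℝ) :
    energy α ε u = ∑ p : Fin N × Fin 2, ((∫ x, ‖Anyon.magneticDeriv α p.1 p.2 u x‖ ^ 2) +
      ∫ x, ‖Anyon.trapMul ε p u x‖ ^ 2) := by
  rw [energy, Fintype.sum_prod_type]
  refine Finset.sum_congr rfl fun j _ => ?_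
  have hD := fun a => (hu.magneticDeriv α j a).integrable_sq
  have hX := fun a => (hu.trapMul ε (j, a)).integrable_sq
  have e : ∀ x, trap ε (x j) * ‖u x‖ ^ 2 = ∑ a, ‖Anyon.trapMul ε (j, a) u x‖ ^ 2 := by
    intro x
    rw [trap_eq_sum, Finset.sum_mul]
    refine Finset.sum_congr rfl fun a _ => ?_
    rw [Anyon.trapMul, norm_mul, Complex.norm_real, Real.norm_eq_abs, mul_pow _ ‖u x‖, sq_abs]
  simp only [e]
  rw [integral_add (integrable_finsetSum _ fun a _ => hD a)
    (integrable_finsetSum _ fun a _ => hX a), integral_finsetSum _ fun a _ => hD a,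
    integral_finsetSum _ fun a _ => hX a, Finset.sum_add_distrib]

theorem hamiltonian_eq (α ε : ℝ) (u : Config N → ℂ) :
    hamiltonian α ε u = ∑ p : Fin N × Fin 2,
      (magneticDeriv α p.1 p.2 (magneticDeriv α p.1 p.2 u) + trapMul ε p (trapMul ε p u)) := by
  funext x
  rw [Finset.sum_apply, Fintype.sum_prod_type, hamiltonian]
  refine Finset.sum_congr rfl fun j _ => ?_
  simp only [Pi.add_apply, Finset.sum_add_distrib]
  congr 1
  rw [trap_eq_sum, Complex.ofReal_sum, Finset.sum_mul]
  refine Finset.sum_congr rfl fun a _ => ?_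
  simp only [trapMul]
  push_cast
  ring

theorem IsTest.hamiltonian {u : Config N → ℂ} (hu : IsTest u) (α ε : ℝ) :
    IsTest (hamiltonian α ε u) := by
  rw [hamiltonian_eq]
  exact IsTest.sum _ fun p _ => ((hu.magneticDeriv α p.1 p.2).magneticDeriv α p.1 p.2).add
    ((hu.trapMul ε p).trapMul ε p)

theorem inner_toLp_right (f : L2 N) {v : Config N → ℂ} (hv : MemLp v 2 volume) :
    inner ℂ f (hv.toLp v) = ∫ x, conj (f x) * v x := by
  rw [L2.inner_def]
  refine integral_congr_ae ?_
  filter_upwards [hv.coeFn_toLp] with x hx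
  rw [hx, RCLike.inner_apply, mul_comm]

theorem inner_toLp_toLp {u v : Config N → ℂ} (hu : MemLp u 2 volume) (hv : MemLp v 2 volume) :
    inner ℂ (hu.toLp u) (hv.toLp v) = ∫ x, conj (u x) * v x := by
  rw [inner_toLp_right]
  refine integral_congr_ae ?_
  filter_upwards [hu.coeFn_toLp] with x hx
  rw [hx]

theorem IsTest.norm_toLp_sq {u : Config N → ℂ} (hu : IsTest u) :
    ‖hu.memLp.toLp u‖ ^ 2 = ∫ x, ‖u x‖ ^ 2 := by
  have h1 : ‖hu.memLp.toLp u‖ₑ ^ 2 = ENNReal.ofReal (∫ x, ‖u x‖ ^ 2) := by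
    rw [L2_enorm_sq, ← hu.lintegral_enorm_sq]
    refine lintegral_congr_ae ?_
    filter_upwards [hu.memLp.coeFn_toLp] with x hx
    rw [hx]
  rw [← ofReal_norm, ← ENNReal.ofReal_pow (norm_nonneg _)] at h1
  exact (ENNReal.ofReal_eq_ofReal_iff (by positivity)
    (integral_nonneg fun x => by positivity)).1 h1

/-- The components of the form norm: the function, its magnetic derivatives and its products with
the scaled coordinates. -/
abbrev FormIndex (N : ℕ) : Type := Option ((Fin N × Fin 2) ⊕ (Fin N × Fin 2))

/-- The Hilbert space that contains the graph of the form. -/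
abbrev FormSpace (N : ℕ) : Type := PiLp 2 (fun _ : FormIndex N => L2 N)

/-- The components of the form norm. -/

def formComp (α ε : ℝ) (u : Config N → ℂ) : FormIndex N → Config N → ℂ
  | none => u
  | some (Sum.inl p) => magneticDeriv α p.1 p.2 u
  | some (Sum.inr p) => trapMul ε p u

theorem IsTest.formComp {u : Config N → ℂ} (hu : IsTest u) (α ε : ℝ) :
    ∀ i, IsTest (formComp α ε u i)
  | none => hu
  | some (Sum.inl p) => hu.magneticDeriv α p.1 p.2
  | some (Sum.inr p) => hu.trapMul ε p

theorem formComp_add (α ε : ℝ) {u v : Config N → ℂ} (hu : IsTest u) (hv : IsTest v) :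
    ∀ i, formComp α ε (u + v) i = formComp α ε u i + formComp α ε v i
  | none => rfl
  | some (Sum.inl p) => magneticDeriv_add hu hv α p.1 p.2
  | some (Sum.inr p) => by
    funext x
    simp only [formComp, trapMul, Pi.add_apply]
    ring

theorem formComp_smul (α ε : ℝ) (c : ℂ) {u : Config N → ℂ} (hu : IsTest u) :
    ∀ i, formComp α ε (c • u) i = c • formComp α ε u i
  | none => rfl
  | some (Sum.inl p) => magneticDeriv_const_smul hu c α p.1 p.2
  | some (Sum.inr p) => by
    funext x
    simp only [formComp, trapMul, Pi.smul_apply, smul_eq_mul]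
    ring

/-- The embedding of the core into the form space. -/

def formEmbed (α ε : ℝ) : coreSpace N →ₗ[ℂ] FormSpace N where
  toFun u := WithLp.toLp 2 fun i => ((isTest_coe u).formComp α ε i).memLp.toLp _
  map_add' u v := by
    ext1 i
    simp only [PiLp.add_apply]
    rw [← MemLp.toLp_add]
    exact MemLp.toLp_congr _ _ (Eventually.of_forall fun x =>
      congrFun (formComp_add α ε (isTest_coe u) (isTest_coe v) i) x)
  map_smul' c u := by
    ext1 i
    simp only [PiLp.smul_apply, RingHom.id_apply]
    rw [← MemLp.toLp_const_smul]
    exact MemLp.toLp_congr _ _ (Eventually.of_forall fun x =>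
      congrFun (formComp_smul α ε c (isTest_coe u) i) x)

theorem formEmbed_apply (α ε : ℝ) (u : coreSpace N) (i : FormIndex N) :
    formEmbed α ε u i = ((isTest_coe u).formComp α ε i).memLp.toLp _ := rfl

theorem formEmbed_none (α ε : ℝ) (u : coreSpace N) :
    formEmbed α ε u none = (isTest_coe u).memLp.toLp _ := rfl

theorem norm_formEmbed_sq (α ε : ℝ) (u : coreSpace N) :
    ‖formEmbed α ε u‖ ^ 2 = ‖(isTest_coe u).memLp.toLp _‖ ^ 2 + energy α ε (u : Config N → ℂ) := by
  rw [PiLp.norm_sq_eq_of_L2, Fintype.sum_option, Fintype.sum_sum_type, (isTest_coe u).energy_eq,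
    Finset.sum_add_distrib]
  have h : ∀ i, ‖formEmbed α ε u i‖ ^ 2 = ∫ x, ‖formComp α ε u i x‖ ^ 2 :=
    fun i => ((isTest_coe u).formComp α ε i).norm_toLp_sq
  simp only [h]
  rw [(isTest_coe u).norm_toLp_sq]
  rfl

/-- The magnetic derivatives and the real multiplications are symmetric, so one factor of each moves
from u to v, where the squares add up to the Hamiltonian. -/
theorem inner_formEmbed (α ε : ℝ) (u v : coreSpace N) :
    inner ℂ (formEmbed α ε u) (formEmbed α ε v) =
      inner ℂ (formEmbed α ε u none) (((isTest_coe v).hamiltonian α ε).memLp.toLp _) +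
        inner ℂ (formEmbed α ε u none) ((isTest_coe v).memLp.toLp _) := by
  have hu := isTest_coe u
  have hv := isTest_coe v
  have hc : Continuous fun x => conj ((u : Config N → ℂ) x) :=
    Complex.continuous_conj.comp hu.continuous
  have iD := fun p : Fin N × Fin 2 =>
    ((hv.magneticDeriv α p.1 p.2).magneticDeriv α p.1 p.2).integrable_mul hc
  have iX := fun p : Fin N × Fin 2 => ((hv.trapMul ε p).trapMul ε p).integrable_mul hc
  have iDX : ∀ p : Fin N × Fin 2, Integrable fun x => conj ((u : Config N → ℂ) x) *
      (magneticDeriv α p.1 p.2 (magneticDeriv α p.1 p.2 v) x + trapMul ε p (trapMul ε p v) x) :=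
    fun p => ((iD p).add (iX p)).congr (Eventually.of_forall fun x => by
      simp only [Pi.add_apply]
      ring)
  rw [PiLp.inner_apply, Fintype.sum_option, Fintype.sum_sum_type, add_comm]
  simp only [formEmbed_apply, inner_toLp_toLp]
  congr 1
  have e : ∀ x, conj ((u : Config N → ℂ) x) * hamiltonian α ε v x =
      ∑ p : Fin N × Fin 2, conj ((u : Config N → ℂ) x) *
        (magneticDeriv α p.1 p.2 (magneticDeriv α p.1 p.2 v) x +
          trapMul ε p (trapMul ε p v) x) := by
    intro x
    rw [hamiltonian_eq, Finset.sum_apply, Finset.mul_sum]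
    rfl
  simp only [formComp, e]
  rw [integral_finsetSum _ fun p _ => iDX p, ← Finset.sum_add_distrib]
  refine Finset.sum_congr rfl fun p _ => ?_
  rw [hu.integral_conj_magneticDeriv (hv.magneticDeriv α p.1 p.2)]
  simp only [mul_add]
  rw [integral_add (iD p) (iX p)]
  congr 2
  funext x
  simp only [trapMul, map_mul, Complex.conj_ofReal]
  ring

/-- The graph of the closure of the form. -/

def formClosure (N : ℕ) (α ε : ℝ) : Submodule ℂ (FormSpace N) :=
  (LinearMap.range (formEmbed (N := N) α ε)).topologicalClosure

instance (α ε : ℝ) : CompleteSpace (formClosure N α ε) :=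
  (Submodule.isClosed_topologicalClosure _).completeSpace_coe

theorem formEmbed_mem (α ε : ℝ) (u : coreSpace N) : formEmbed α ε u ∈ formClosure N α ε :=
  Submodule.le_topologicalClosure _ (LinearMap.mem_range_self _ u)

theorem formClosure_induction {α ε : ℝ} {P : FormSpace N → Prop} (hc : IsClosed {p | P p})
    (h : ∀ u, P (formEmbed α ε u)) {p : FormSpace N} (hp : p ∈ formClosure N α ε) : P p := by
  have hsub : (LinearMap.range (formEmbed (N := N) α ε) : Set (FormSpace N)) ⊆ {p | P p} := by
    rintro _ ⟨u, rfl⟩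
    exact h u
  exact closure_minimal hsub hc hp

theorem exists_seq_formEmbed {α ε : ℝ} {p : FormSpace N} (hp : p ∈ formClosure N α ε) :
    ∃ u : ℕ → coreSpace N, Tendsto (fun n => formEmbed α ε (u n)) atTop (𝓝 p) := by
  obtain ⟨y, hy, hlim⟩ := mem_closure_iff_seq_limit.1 hp
  choose u hu using hy
  exact ⟨u, by simpa only [hu] using hlim⟩

theorem continuous_formSpace_apply (i : FormIndex N) : Continuous fun p : FormSpace N => p i :=
  (PiLp.proj 2 (fun _ : FormIndex N => L2 N) i : FormSpace N →L[ℂ] L2 N).continuous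

/-- It is the set of common fixed points of the isometries induced by the permutations. -/
theorem isClosed_L2sym : IsClosed (L2sym N : Set (L2 N)) := by
  have : (L2sym N : Set (L2 N)) = ⋂ σ : Equiv.Perm (Fin N),
      {φ | Lp.compMeasurePreserving _ (measurePreserving_perm σ) φ = φ} := by
    ext φ
    simp only [Set.mem_iInter, Set.mem_ofPred_eq]
    refine forall_congr' fun σ => ?_
    have h := Lp.coeFn_compMeasurePreserving φ (measurePreserving_perm σ)
    constructor
    · intro hσ
      exact Lp.ext (h.trans hσ)
    · intro hσ
      have h2 : φ ∘ (fun x : Config N => x ∘ σ) =ᵐ[volume] φ := by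
        rw [hσ] at h
        exact h.symm
      exact h2
  rw [this]
  exact isClosed_iInter fun σ => isClosed_eq
    (Lp.isometry_compMeasurePreserving (measurePreserving_perm σ)).continuous continuous_id

theorem toLp_mem_L2sym (u : coreSpace N) : (isTest_coe u).memLp.toLp _ ∈ L2sym N := by
  intro σ
  have h := (isTest_coe u).memLp.coeFn_toLp
  filter_upwards [h, (measurePreserving_perm σ).quasiMeasurePreserving.ae_eq_comp h] with x h1 h2
  simp only [Function.comp_apply] at h2
  rw [h1, h2]
  exact IsCore.symm u.2 σ x

theorem none_mem_L2sym {α ε : ℝ} {p : FormSpace N} (hp : p ∈ formClosure N α ε) :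
    p none ∈ L2sym N :=
  formClosure_induction (P := fun p => p none ∈ L2sym N)
    (isClosed_L2sym.preimage (continuous_formSpace_apply none)) toLp_mem_L2sym hp

/-- The identity passes from the core to its closure by continuity. Its right side involves only the
first component, which links the form inner product to the adjoint in `friedrichsGraph` and makes a
separate proof of closability unnecessary. -/
theorem inner_formClosure {α ε : ℝ} {p : FormSpace N} (hp : p ∈ formClosure N α ε)
    (v : coreSpace N) : inner ℂ p (formEmbed α ε v) =
      inner ℂ (p none) (((isTest_coe v).hamiltonian α ε).memLp.toLp _) +
        inner ℂ (p none) ((isTest_coe v).memLp.toLp _) := by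
  have h0 := continuous_formSpace_apply (N := N) none
  refine formClosure_induction (P := fun p => inner ℂ p (formEmbed α ε v) =
      inner ℂ (p none) (((isTest_coe v).hamiltonian α ε).memLp.toLp _) +
        inner ℂ (p none) ((isTest_coe v).memLp.toLp _)) ?_ (fun u => inner_formEmbed α ε u v) hp
  exact isClosed_eq (continuous_id.inner continuous_const)
    ((h0.inner continuous_const).add (h0.inner continuous_const))

theorem eLpNorm_sub_eq (u : coreSpace N) (φ : L2 N) :
    eLpNorm (fun x => (u : Config N → ℂ) x - φ x) 2 volume =
      ENNReal.ofReal ‖(isTest_coe u).memLp.toLp _ - φ‖ := by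
  rw [ofReal_norm, Lp.enorm_def]
  refine eLpNorm_congr_ae ?_
  filter_upwards [Lp.coeFn_sub ((isTest_coe u).memLp.toLp _) φ, (isTest_coe u).memLp.coeFn_toLp]
    with x h1 h2
  rw [h1, Pi.sub_apply, h2]

/-- The form domain is the image of the closure of the graph of the form. -/

theorem mem_formDomain_iff {α ε : ℝ} {φ : L2 N} :
    φ ∈ formDomain N α ε ↔ ∃ p ∈ formClosure N α ε, p none = φ := by
  constructor
  · rintro ⟨u, hu, hE, hL⟩
    set w : ℕ → coreSpace N := fun n => ⟨u n, hu n⟩ with hw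
    have hL' : Tendsto (fun n => formEmbed α ε (w n) none) atTop (𝓝 φ) := by
      rw [tendsto_iff_norm_sub_tendsto_zero]
      have : ∀ n, eLpNorm (fun x => u n x - φ x) 2 volume =
          ENNReal.ofReal ‖formEmbed α ε (w n) none - φ‖ := fun n => eLpNorm_sub_eq (w n) φ
      simp only [this] at hL
      have h := (ENNReal.tendsto_toReal ENNReal.zero_ne_top).comp hL
      simpa [Function.comp_def, ENNReal.toReal_ofReal (norm_nonneg _)] using h
    have hcauchy : CauchySeq fun n => formEmbed α ε (w n) := by
      rw [Metric.cauchySeq_iff]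
      intro r hr
      obtain ⟨n₁, h1⟩ := hE (r ^ 2 / 2) (by positivity)
      obtain ⟨n₂, h2⟩ := Metric.cauchySeq_iff.1 hL'.cauchySeq (r / 2) (by positivity)
      refine ⟨max n₁ n₂, fun m hm n hn => ?_⟩
      -- The energy contributes less than r²/2 and the squared L² distance less than r²/4, together
      -- below r².
      have e1 := h1 m (le_of_max_le_left hm) n (le_of_max_le_left hn)
      have e2 := h2 m (le_of_max_le_right hm) n (le_of_max_le_right hn)
      rw [dist_eq_norm] at e2 ⊢
      have e3 := norm_formEmbed_sq α ε (w m - w n)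
      rw [← formEmbed_none, map_sub, PiLp.sub_apply] at e3
      have e4 : energy α ε ((w m - w n : coreSpace N) : Config N → ℂ) < r ^ 2 / 2 := e1
      refine lt_of_pow_lt_pow_left₀ 2 hr.le ?_
      nlinarith [norm_nonneg (formEmbed α ε (w m) none - formEmbed α ε (w n) none)]
    obtain ⟨p, hp⟩ := cauchySeq_tendsto_of_complete hcauchy
    refine ⟨p, ?_, ?_⟩
    · exact (Submodule.isClosed_topologicalClosure _).mem_of_tendsto hp
        (Eventually.of_forall fun n => formEmbed_mem α ε (w n))
    · exact tendsto_nhds_unique (((continuous_formSpace_apply none).tendsto p).comp hp) hL'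
  · rintro ⟨p, hp, rfl⟩
    obtain ⟨u, hu⟩ := exists_seq_formEmbed hp
    refine ⟨fun n => u n, fun n => (u n).2, fun δ hδ => ?_, ?_⟩
    · obtain ⟨n₀, h⟩ := Metric.cauchySeq_iff.1 hu.cauchySeq (Real.sqrt δ) (Real.sqrt_pos.2 hδ)
      refine ⟨n₀, fun m hm n hn => ?_⟩
      have e1 := h m hm n hn
      have e3 := norm_formEmbed_sq α ε (u m - u n)
      rw [dist_eq_norm, ← map_sub] at e1
      have e2 : ‖formEmbed α ε (u m - u n)‖ ^ 2 < δ := by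
        rw [← Real.sq_sqrt hδ.le]
        exact pow_lt_pow_left₀ e1 (norm_nonneg _) two_ne_zero
      have e4 : energy α ε ((u m : Config N → ℂ) - (u n : Config N → ℂ)) =
        energy α ε ((u m - u n : coreSpace N) : Config N → ℂ) := rfl
      rw [e4]
      nlinarith [norm_nonneg ((isTest_coe (u m - u n)).memLp.toLp _)]
    · simp only [eLpNorm_sub_eq]
      have h1 := ((continuous_formSpace_apply none).tendsto p).comp hu
      rw [tendsto_iff_norm_sub_tendsto_zero] at h1
      have h2 := ENNReal.tendsto_ofReal h1
      rw [ENNReal.ofReal_zero] at h2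
      exact h2

/-! ### The resolvent by orthogonal projection -/

/-- The projection of the form space to its first component. -/

def formProj (N : ℕ) : FormSpace N →L[ℂ] L2 N :=
  PiLp.proj 2 (fun _ : FormIndex N => L2 N) none

theorem formProj_apply (p : FormSpace N) : formProj N p = p none := rfl

/-- The vector of the closure of the form that represents the functional `⟨f, ·⟩`. -/

def formSolve (α ε : ℝ) : L2 N →L[ℂ] FormSpace N :=
  (formClosure N α ε).starProjection ∘L ContinuousLinearMap.adjoint (formProj N)

theorem formSolve_mem (α ε : ℝ) (f : L2 N) : formSolve α ε f ∈ formClosure N α ε :=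
  Submodule.starProjection_apply_mem _ _

/-- This is the Riesz representation of w ↦ ⟨f, w none⟩ on the closure: the adjoint represents it on
the whole space, and projecting does not change the pairing with vectors of the closure. -/
theorem inner_formSolve (α ε : ℝ) (f : L2 N) {w : FormSpace N} (hw : w ∈ formClosure N α ε) :
    inner ℂ (formSolve α ε f) w = inner ℂ f (w none) := by
  have h := Submodule.starProjection_inner_eq_zero (K := formClosure N α ε)
    (ContinuousLinearMap.adjoint (formProj N) f) w hw
  rw [inner_sub_left, sub_eq_zero, ContinuousLinearMap.adjoint_inner_left, formProj_apply] at h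
  exact h.symm

/-- Testing against the core suffices, since the core is dense in the closure. -/
theorem eq_formSolve {α ε : ℝ} {f : L2 N} {p : FormSpace N} (hp : p ∈ formClosure N α ε)
    (h : ∀ v : coreSpace N, inner ℂ p (formEmbed α ε v) = inner ℂ f (formEmbed α ε v none)) :
    p = formSolve α ε f := by
  refine (Submodule.eq_starProjection_of_mem_of_inner_eq_zero hp fun w hw => ?_).symm
  change inner ℂ (ContinuousLinearMap.adjoint (formProj N) f - p) w = 0
  rw [inner_sub_left, sub_eq_zero, ContinuousLinearMap.adjoint_inner_left, formProj_apply]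
  refine formClosure_induction (P := fun w => inner ℂ f (w none) = inner ℂ p w) ?_
    (fun v => (h v).symm) hw
  exact isClosed_eq (continuous_const.inner (continuous_formSpace_apply none))
    (continuous_const.inner continuous_id)

/-- The inverse of `H + 1` on `L²_sym`, with values in `L²`. -/

def formResolvent (N : ℕ) (α ε : ℝ) : L2sym N →L[ℂ] L2 N :=
  formProj N ∘L formSolve α ε ∘L (L2sym N).subtypeL

theorem formResolvent_apply (α ε : ℝ) (f : L2sym N) :
    formResolvent N α ε f = formSolve α ε (f : L2 N) none := rfl

theorem formResolvent_mem (α ε : ℝ) (f : L2sym N) : formResolvent N α ε f ∈ L2sym N := by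
  rw [formResolvent_apply]
  exact none_mem_L2sym (formSolve_mem α ε (f : L2 N))

/-- The inverse of `H + 1` on `L²_sym`. -/

def friedrichsResolvent (N : ℕ) (α ε : ℝ) : L2sym N →L[ℂ] L2sym N :=
  (formResolvent N α ε).codRestrict (L2sym N) (formResolvent_mem α ε)

theorem friedrichsResolvent_apply (α ε : ℝ) (f : L2sym N) :
    (friedrichsResolvent N α ε f : L2 N) = formSolve α ε (f : L2 N) none := rfl

/-- The adjoint equation for φ against core functions is, by `inner_formClosure`, the weak equation
for any lift p of φ to the closure, and that equation has `formSolve` as its only solution. -/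
theorem isResolvent_friedrichsResolvent (α ε : ℝ) :
    IsResolventAtNegOne (friedrichsGraph N α ε) (friedrichsResolvent N α ε) := by
  intro φ f
  have hgraph : (φ, f - φ) ∈ friedrichsGraph N α ε ↔ (φ : L2 N) ∈ formDomain N α ε ∧
      ∀ v : coreSpace N, inner ℂ (φ : L2 N) (((isTest_coe v).hamiltonian α ε).memLp.toLp _) +
        inner ℂ (φ : L2 N) ((isTest_coe v).memLp.toLp _) =
          inner ℂ (f : L2 N) ((isTest_coe v).memLp.toLp _) := by
    refine and_congr_right fun _ => ⟨fun h v => ?_, fun h v hv => ?_⟩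
    · have h1 := h v v.2
      rw [← inner_toLp_right _ ((isTest_coe v).hamiltonian α ε).memLp,
        ← inner_toLp_right _ (isTest_coe v).memLp, Submodule.coe_sub, inner_sub_left] at h1
      rw [h1]
      ring
    · have h1 := h ⟨v, hv⟩
      rw [← inner_toLp_right _ (hv.isTest.hamiltonian α ε).memLp,
        ← inner_toLp_right _ hv.isTest.memLp, Submodule.coe_sub, inner_sub_left, ← h1]
      ring
  rw [hgraph]
  constructor
  · rintro ⟨hdom, h⟩
    obtain ⟨p, hp, hpφ⟩ := mem_formDomain_iff.1 hdom
    have hps : p = formSolve α ε (f : L2 N) := eq_formSolve hp fun v => by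
      rw [inner_formClosure hp, hpφ, h v]
      rfl
    refine Subtype.ext ?_
    rw [friedrichsResolvent_apply, ← hps, hpφ]
  · rintro rfl
    refine ⟨mem_formDomain_iff.2 ⟨_, formSolve_mem α ε _, rfl⟩, fun v => ?_⟩
    rw [friedrichsResolvent_apply, ← inner_formClosure (formSolve_mem α ε _), inner_formSolve α ε _
      (formEmbed_mem α ε v)]
    rfl

/-! ### Compactness of the resolvent -/

theorem IsTest.kinetic_le_energy {u : Config N → ℂ} (hu : IsTest u) (α ε : ℝ) :
    kinetic α u ≤ energy α ε u := by
  rw [hu.energy_eq, Finset.sum_add_distrib, Fintype.sum_prod_type]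
  exact le_add_of_nonneg_right (Finset.sum_nonneg fun p _ => integral_nonneg fun x => by positivity)

/-- The factor 1 + ε² dominates both 1 and ε², so it undoes either trap coefficient. -/
theorem sq_le_trapCoeff {ε : ℝ} (hε : 0 < ε) (a : Fin 2) (t : ℝ) :
    t ^ 2 ≤ (1 + ε ^ 2) * (trapCoeff ε a * t) ^ 2 := by
  have h : 1 ≤ (1 + ε ^ 2) * trapCoeff ε a ^ 2 := by
    fin_cases a
    · simp [trapCoeff]
      positivity
    · simp only [trapCoeff, Fin.mk_one, Matrix.cons_val_one, Matrix.cons_val_fin_one]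
      rw [inv_pow, ← div_eq_mul_inv, one_le_div (by positivity)]
      linarith
  rw [mul_pow, ← mul_assoc]
  exact le_mul_of_one_le_left (sq_nonneg t) h

theorem IsTest.integral_coord_sq_le {u : Config N → ℂ} (hu : IsTest u) (α : ℝ) {ε : ℝ}
    (hε : 0 < ε) (p : Fin N × Fin 2) :
    ∫ x, x p.1 p.2 ^ 2 * ‖u x‖ ^ 2 ≤ (1 + ε ^ 2) * energy α ε u := by
  have h1 : ∫ x, x p.1 p.2 ^ 2 * ‖u x‖ ^ 2 ≤ ∫ x, (1 + ε ^ 2) * ‖Anyon.trapMul ε p u x‖ ^ 2 := by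
    refine integral_mono (hu.integrable_norm_sq ((contDiff_coord p.1 p.2).continuous.pow 2))
      ((hu.trapMul ε p).integrable_sq.const_mul _) fun x => ?_
    simp only [Anyon.trapMul]
    rw [norm_mul, mul_pow _ ‖u x‖, Complex.norm_real, Real.norm_eq_abs, sq_abs, ← mul_assoc]
    exact mul_le_mul_of_nonneg_right (sq_le_trapCoeff hε p.2 _) (by positivity)
  refine h1.trans ?_
  rw [integral_const_mul]
  refine mul_le_mul_of_nonneg_left ?_ (by positivity)
  rw [hu.energy_eq]
  have h0 : ∀ q : Fin N × Fin 2, 0 ≤ (∫ x, ‖Anyon.magneticDeriv α q.1 q.2 u x‖ ^ 2) +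
      ∫ x, ‖Anyon.trapMul ε q u x‖ ^ 2 := fun q =>
    add_nonneg (integral_nonneg fun x => by positivity) (integral_nonneg fun x => by positivity)
  refine le_trans ?_ (Finset.single_le_sum (fun q _ => h0 q) (Finset.mem_univ p))
  exact le_add_of_nonneg_left (integral_nonneg fun x => by positivity)

theorem energy_le_norm_formEmbed_sq (α ε : ℝ) (u : coreSpace N) :
    energy α ε (u : Config N → ℂ) ≤ ‖formEmbed α ε u‖ ^ 2 := by
  rw [norm_formEmbed_sq]
  exact le_add_of_nonneg_left (by positivity)

theorem isCompactOperator_friedrichsResolvent {α ε : ℝ} (hα : ∀ q : ℤ, q ≠ 0 → α ≠ 2 * (q : ℝ))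
    (hε : 0 < ε) : IsCompactOperator (friedrichsResolvent N α ε) := by
  obtain ⟨C, hC, hgrad⟩ := exists_integral_partialDeriv_sq_le N hα
  set K : ℝ := (Fintype.card (Fin N × Fin 2)) * (C + (1 + ε ^ 2)) with hK
  have hK0 : 0 ≤ K := by positivity
  have hbound : ∀ u : coreSpace N, ∑ p : Fin N × Fin 2,
      ((∫ x, ‖partialDeriv p.1 p.2 (u : Config N → ℂ) x‖ ^ 2) +
        ∫ x, x p.1 p.2 ^ 2 * ‖(u : Config N → ℂ) x‖ ^ 2) ≤ K * ‖formEmbed α ε u‖ ^ 2 := by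
    intro u
    have hu := isTest_coe u
    have hE := energy_le_norm_formEmbed_sq α ε u
    have hsum : ∀ p : Fin N × Fin 2, (∫ x, ‖partialDeriv p.1 p.2 (u : Config N → ℂ) x‖ ^ 2) +
        ∫ x, x p.1 p.2 ^ 2 * ‖(u : Config N → ℂ) x‖ ^ 2 ≤
          (C + (1 + ε ^ 2)) * ‖formEmbed α ε u‖ ^ 2 := by
      intro p
      have h1 := (hgrad u u.2 p.1 p.2).trans
        (mul_le_mul_of_nonneg_left ((hu.kinetic_le_energy α ε).trans hE) hC)
      have h2 := (hu.integral_coord_sq_le α hε p).trans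
        (mul_le_mul_of_nonneg_left hE (show 0 ≤ 1 + ε ^ 2 by positivity))
      rw [add_mul]
      exact add_le_add h1 h2
    refine (Finset.sum_le_sum fun p _ => hsum p).trans (le_of_eq ?_)
    rw [Finset.sum_const, Finset.card_univ, nsmul_eq_mul, hK, mul_assoc]
  -- The bound on the core is a closed condition in the form space, so it holds on the whole
  -- closure.
  have happrox : ∀ n : ℕ, ∃ P : L2 N →L[ℂ] L2 N, IsCompactOperator P ∧
      ∀ p ∈ formClosure N α ε, ‖p none - P (p none)‖ ^ 2 ≤ (1 / ((n : ℝ) + 1)) * K * ‖p‖ ^ 2 := by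
    intro n
    obtain ⟨P, hP, hPu⟩ := exists_compact_approx N (η := 1 / ((n : ℝ) + 1)) (by positivity)
    refine ⟨P, hP, fun p hp => ?_⟩
    have h0 := continuous_formSpace_apply (N := N) none
    refine formClosure_induction (P := fun p : FormSpace N => ‖p none - P (p none)‖ ^ 2 ≤
      (1 / ((n : ℝ) + 1)) * K * ‖p‖ ^ 2) ?_ (fun u => ?_) hp
    · exact isClosed_le ((h0.sub (P.continuous.comp h0)).norm.pow 2)
        (continuous_const.mul (continuous_norm.pow 2))
    · refine (hPu u (isTest_coe u)).trans ?_
      rw [mul_assoc]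
      exact mul_le_mul_of_nonneg_left (hbound u) (by positivity)
  choose P hP hPu using happrox
  set R₀ := formResolvent N α ε with hR₀
  set S : L2sym N →L[ℂ] FormSpace N := formSolve α ε ∘L (L2sym N).subtypeL with hS
  -- The vector R₀ f is the first component of S f, which lies in the closure, so the error is at
  -- most √(K/(n+1)) ‖S‖ in operator norm.
  have hlim : Tendsto (fun n => P n ∘L R₀) atTop (𝓝 R₀) := by
    refine (tendsto_iff_norm_sub_tendsto_zero (E := L2sym N →L[ℂ] L2 N)).2 ?_
    have hle : ∀ n, ‖P n ∘L R₀ - R₀‖ ≤ Real.sqrt ((1 / ((n : ℝ) + 1)) * K) * ‖S‖ := by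
      intro n
      refine ContinuousLinearMap.opNorm_le_bound _ (by positivity) fun f => ?_
      have h1 := hPu n (S f) (formSolve_mem α ε _)
      have h2 : ‖(P n ∘L R₀ - R₀) f‖ ^ 2 ≤ (1 / ((n : ℝ) + 1)) * K * ‖S f‖ ^ 2 := by
        rw [sub_apply, norm_sub_rev]
        exact h1
      have h3 : ‖(P n ∘L R₀ - R₀) f‖ ≤ Real.sqrt ((1 / ((n : ℝ) + 1)) * K) * ‖S f‖ := by
        refine le_of_sq_le_sq ?_ (by positivity)
        rw [mul_pow, Real.sq_sqrt (by positivity)]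
        exact h2
      rw [mul_assoc]
      exact h3.trans (mul_le_mul_of_nonneg_left (S.le_opNorm f) (Real.sqrt_nonneg _))
    refine squeeze_zero (fun n => ContinuousLinearMap.opNorm_nonneg _) hle ?_
    have h1 := (tendsto_one_div_add_atTop_nhds_zero_nat (𝕜 := ℝ)).mul_const K
    have h2 := ((Real.continuous_sqrt.tendsto _).comp h1).mul_const ‖S‖
    simpa [Function.comp_def] using h2
  have hcomp : IsCompactOperator R₀ := isCompactOperator_of_tendsto hlim
    (Eventually.of_forall fun n => (hP n).comp_clm R₀)
  exact hcomp.codRestrict (formResolvent_mem α ε) isClosed_L2sym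

/-! ### Inclusion of the form domain in the weighted Sobolev space -/

theorem integral_mul_eq_inner (f : L2 N) {ψ : Config N → ℂ} (hψ : Continuous ψ)
    (hs : HasCompactSupport ψ) :
    ∫ x, f x * ψ x = conj (inner ℂ f ((((Complex.continuous_conj.comp hψ).memLp_of_hasCompactSupport
      (p := 2) (μ := (volume : Measure (Config N))) (hs.comp_left (map_zero _))).toLp _))) := by
  rw [inner_toLp_right, ← integral_conj]
  simp

theorem toLp_partialDeriv_sub (u v : coreSpace N) (j : Fin N) (a : Fin 2) :
    ((isTest_coe (u - v)).partialDeriv j a).memLp.toLp _ =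
      ((isTest_coe u).partialDeriv j a).memLp.toLp _ -
        ((isTest_coe v).partialDeriv j a).memLp.toLp _ := by
  rw [← MemLp.toLp_sub]
  refine MemLp.toLp_congr _ _ (Eventually.of_forall fun x => ?_)
  simp only [partialDeriv, Submodule.coe_sub, Pi.sub_apply]
  rw [fderiv_sub ((isTest_coe u).differentiable x) ((isTest_coe v).differentiable x)]
  rfl

theorem formDomain_subset_sobolevH1 {α ε : ℝ} (hα : ∀ q : ℤ, q ≠ 0 → α ≠ 2 * (q : ℝ)) :
    formDomain N α ε ⊆ sobolevH1 N := by
  intro φ hφ j a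
  obtain ⟨p, hp, rfl⟩ := mem_formDomain_iff.1 hφ
  obtain ⟨u, hu⟩ := exists_seq_formEmbed hp
  obtain ⟨C, hC, hgrad⟩ := exists_integral_partialDeriv_sq_le N hα
  set d : ℕ → L2 N := fun n => ((isTest_coe (u n)).partialDeriv j a).memLp.toLp _ with hd
  -- The Hardy-based gradient bound is applied to differences of core functions, which are again in
  -- the core.
  have hle : ∀ m n, ‖d m - d n‖ ≤ Real.sqrt C * ‖formEmbed α ε (u m) - formEmbed α ε (u n)‖ := by
    intro m n
    refine le_of_sq_le_sq ?_ (by positivity)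
    rw [mul_pow, Real.sq_sqrt hC, hd, ← toLp_partialDeriv_sub,
      ((isTest_coe (u m - u n)).partialDeriv j a).norm_toLp_sq, ← map_sub]
    refine (hgrad _ (u m - u n).2 j a).trans (mul_le_mul_of_nonneg_left ?_ hC)
    exact ((isTest_coe (u m - u n)).kinetic_le_energy α ε).trans
      (energy_le_norm_formEmbed_sq α ε _)
  have hcauchy : CauchySeq d := by
    rw [Metric.cauchySeq_iff]
    intro r hr
    obtain ⟨n₀, h⟩ := Metric.cauchySeq_iff.1 hu.cauchySeq (r / (Real.sqrt C + 1)) (by positivity)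
    refine ⟨n₀, fun m hm n hn => ?_⟩
    have h1 := h m hm n hn
    rw [dist_eq_norm, lt_div_iff₀ (by positivity)] at h1
    rw [dist_eq_norm]
    refine (hle m n).trans_lt (lt_of_le_of_lt ?_ h1)
    nlinarith [norm_nonneg (formEmbed α ε (u m) - formEmbed α ε (u n))]
  obtain ⟨g, hg⟩ := cauchySeq_tendsto_of_complete hcauchy
  refine ⟨g, fun ψ hψ hs => ?_⟩
  have hψ' : Continuous (partialDeriv j a ψ) :=
    ((hψ.fderiv_right (m := ∞) (by simp)).clm_apply contDiff_const).continuous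
  have hs' : HasCompactSupport (partialDeriv j a ψ) :=
    hs.isCompact.of_isClosed_subset (isClosed_tsupport _) (tsupport_fderiv_apply_subset ℝ _)
  have hconv : ∀ {F : ℕ → L2 N} {f : L2 N}, Tendsto F atTop (𝓝 f) → ∀ {χ : Config N → ℂ},
      Continuous χ → HasCompactSupport χ →
        Tendsto (fun n => ∫ x, F n x * χ x) atTop (𝓝 (∫ x, f x * χ x)) := by
    intro F f hF χ hχ hχs
    simp only [integral_mul_eq_inner _ hχ hχs]
    exact (Complex.continuous_conj.tendsto _).comp (hF.inner tendsto_const_nhds)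
  have h0 : Tendsto (fun n => formEmbed α ε (u n) none) atTop (𝓝 (p none)) :=
    ((continuous_formSpace_apply none).tendsto p).comp hu
  have l1 := hconv h0 hψ' hs'
  have l2 := (hconv hg hψ.continuous hs).neg
  refine tendsto_nhds_unique l1 (l2.congr fun n => ?_)
  -- The function ψ need not vanish near the diagonals; u n does, and it has compact support, so
  -- there are no boundary terms and the limit is a weak derivative on the whole space.
  have ibp := (isTest_coe (u n)).integral_mul_partialDeriv hψ j a
  have e1 : ∫ x, formEmbed α ε (u n) none x * partialDeriv j a ψ x =
      ∫ x, (u n : Config N → ℂ) x * partialDeriv j a ψ x := by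
    refine integral_congr_ae ?_
    filter_upwards [(isTest_coe (u n)).memLp.coeFn_toLp] with x hx
    rw [formEmbed_none, hx]
  have e2 : ∫ x, d n x * ψ x = ∫ x, partialDeriv j a (u n : Config N → ℂ) x * ψ x := by
    refine integral_congr_ae ?_
    filter_upwards [((isTest_coe (u n)).partialDeriv j a).memLp.coeFn_toLp] with x hx
    rw [hd]
    simp only
    rw [hx]
  rw [e1, e2, ibp]

/-- Two successive subsequences make both components converge almost everywhere, where
multiplication by a coordinate is continuous. -/
theorem coeFn_formClosure_inr {α ε : ℝ} {p : FormSpace N} (hp : p ∈ formClosure N α ε)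
    (q : Fin N × Fin 2) : p (some (Sum.inr q)) =ᵐ[volume] trapMul ε q (p none) := by
  obtain ⟨u, hu⟩ := exists_seq_formEmbed hp
  have h0 : Tendsto (fun n => formEmbed α ε (u n) none) atTop (𝓝 (p none)) :=
    ((continuous_formSpace_apply none).tendsto p).comp hu
  have h1 : Tendsto (fun n => formEmbed α ε (u n) (some (Sum.inr q))) atTop
      (𝓝 (p (some (Sum.inr q)))) :=
    ((continuous_formSpace_apply (some (Sum.inr q))).tendsto p).comp hu
  obtain ⟨ns, hns, hae0⟩ := (tendstoInMeasure_of_tendsto_Lp h0).exists_seq_tendsto_ae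
  obtain ⟨ms, hms, hae1⟩ :=
    (tendstoInMeasure_of_tendsto_Lp (h1.comp hns.tendsto_atTop)).exists_seq_tendsto_ae
  have hrep0 : ∀ᵐ x, ∀ n, formEmbed α ε (u n) none x = (u n : Config N → ℂ) x :=
    ae_all_iff.2 fun n => (isTest_coe (u n)).memLp.coeFn_toLp
  have hrep1 : ∀ᵐ x, ∀ n, formEmbed α ε (u n) (some (Sum.inr q)) x =
      trapMul ε q (u n : Config N → ℂ) x :=
    ae_all_iff.2 fun n => ((isTest_coe (u n)).trapMul ε q).memLp.coeFn_toLp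
  filter_upwards [hae0, hae1, hrep0, hrep1] with x l0 l1 r0 r1
  simp only [Function.comp_apply, r1] at l1
  simp only [r0] at l0
  exact tendsto_nhds_unique l1 ((l0.comp hms.tendsto_atTop).const_mul _)

theorem formDomain_subset_sobolevH1V {α ε : ℝ} (hα : ∀ q : ℤ, q ≠ 0 → α ≠ 2 * (q : ℝ))
    (hε : 0 < ε) : formDomain N α ε ⊆ sobolevH1V N := by
  intro φ hφ
  refine ⟨formDomain_subset_sobolevH1 hα hφ, fun j => ?_⟩
  obtain ⟨p, hp, rfl⟩ := mem_formDomain_iff.1 hφ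
  have hq : ∀ a, MemLp (fun x => ‖trapMul ε (j, a) (p none) x‖) 2 volume := fun a =>
    ((Lp.memLp (p (some (Sum.inr (j, a))))).ae_eq (coeFn_formClosure_inr hp (j, a))).norm
  have hsum : MemLp (fun x => (1 + ε ^ 2) * (‖trapMul ε (j, 0) (p none) x‖ +
      ‖trapMul ε (j, 1) (p none) x‖)) 2 volume := ((hq 0).add (hq 1)).const_mul _
  refine hsum.mono' ?_ (Eventually.of_forall fun x => ?_)
  · have hc : Continuous fun x : Config N => ((‖x j‖ : ℝ) : ℂ) :=
      Complex.continuous_ofReal.comp (continuous_apply j).norm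
    exact hc.aestronglyMeasurable.mul (Lp.aestronglyMeasurable _)
  · have h1 : ∀ a, |x j a| ≤ (1 + ε ^ 2) * |trapCoeff ε a * x j a| := by
      intro a
      refine le_of_sq_le_sq ?_ (by positivity)
      rw [sq_abs, mul_pow, sq_abs]
      refine (sq_le_trapCoeff hε a (x j a)).trans (mul_le_mul_of_nonneg_right ?_ (sq_nonneg _))
      nlinarith [sq_nonneg ε]
    have h2 : ‖x j‖ ≤ |x j 0| + |x j 1| := by
      refine le_of_sq_le_sq ?_ (by positivity)
      rw [EuclideanSpace.norm_sq_eq, Fin.sum_univ_two, Real.norm_eq_abs, Real.norm_eq_abs]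
      nlinarith [abs_nonneg (x j 0), abs_nonneg (x j 1)]
    have e : ∀ a, ‖trapMul ε (j, a) (p none) x‖ = |trapCoeff ε a * x j a| * ‖p none x‖ := by
      intro a
      rw [trapMul, norm_mul, Complex.norm_real, Real.norm_eq_abs]
    rw [norm_mul, Complex.norm_real, norm_norm, e, e, ← add_mul, ← mul_assoc]
    refine mul_le_mul_of_nonneg_right ?_ (norm_nonneg _)
    rw [mul_add]
    exact h2.trans (add_le_add (h1 0) (h1 1))

end Anyon

end

theorem corollary2p4 (N : ℕ) (hN : 2 ≤ N) (α ε : ℝ)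
    (hα : ∀ q : ℤ, q ≠ 0 → α ≠ 2 * (q : ℝ)) (hε : 0 < ε) :
    Anyon.formDomain N α ε ⊆ Anyon.sobolevH1V N ∧
    ∃ R : Anyon.L2sym N →L[ℂ] Anyon.L2sym N,
      Anyon.IsResolventAtNegOne (Anyon.friedrichsGraph N α ε) R ∧ IsCompactOperator R :=
  ⟨Anyon.formDomain_subset_sobolevH1V hα hε, Anyon.friedrichsResolvent N α ε,
    Anyon.isResolvent_friedrichsResolvent α ε, Anyon.isCompactOperator_friedrichsResolvent hα hε⟩
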